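/- **Conventions.** All monoids are commutative with zero, and all modules over them are pointed ($0$ acts by the base point $0$). Let $(A;A^+)$ be an $\mathbb F_1$-domain: $A$ is a monoid with $0\neq 1$, and $A^+\subseteq A$ is a submonoid containing $0$ such that $A^+$ is sharp ($1$ is its only invertible element), $A^+\setminus 0$ is a cancellative monoid, $A$ is a localisation of $A^+$, and $A^+$ is integrally closed in $A$ ($f\in A$ and $f^n\in A^+$ for some $n\ge 1$ imply $f\in A^+$). Let $\mathbb B[A]=\mathbb B[A;A^+]$ be the idempotent semiring of finitely generated $A^+$-submodules of $A$, with union as addition and elementwise product as multiplication. Let $\mu$ be a $\mathbb B[A]$-module, with addition written $\vee$ and zero written $-\infty$, ordered by $X\le Y\Leftrightarrow X\vee Y=Y$; the monoid $A$ acts on $\mu$ through $f\mapsto A^+f\in\mathbb B[A]$. An element $X\in\mu$ is *primitive* if whenever $X=\bigvee_{i\in I}X_i$ with $I$ finite (possibly empty), $X=X_i$ for some $i$. Let $M=\mathrm{Prim}\,\mu$ denote the set of primitive elements together with $-\infty$, with the induced order. A *po-module* over $(A;A^+)$ is an $A$-module with a partial order such that $fv\le gv$ for $f\in A^+g$, and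 $v\le w\Rightarrow fv\le fw$ for $f\in A$; with the monotone $A$-linear maps these form a category $\mathbf{PO}\mathrm{Mod}_A$. An $A$-module is *free* if it is isomorphic to a wedge sum $\bigvee_{i\in I}A_i$ of copies $A_i=Ax_i$ of $A$; the $A_i$ are its cyclic factors. **Theorem.** The module $\mu$ is finitely generated and projective over $\mathbb B[A]$ if and only if the following four conditions hold: 1. $\mu$ has unique irredundant primitive decompositions: every element of $\mu$ is the join of exactly one finite set of pairwise incomparable primitive elements; 2. $M=\mathrm{Prim}\,\mu$ is an $A$-submodule of $\mu$, and it is free as an $A$-module; 3. the order of $M$ is non-degenerate: on each cyclic factor of $M$ it is the $A^+$-divisibility order, $x\le y\Leftrightarrow x\in A^+y$; 4. the order of $M$ is presented by a finite quiver: there are a basis $(x_i)_{i\in I}$ of $M$ with $I$ finite, a quiver $Q$ with vertex set $I$ and finitely many edges, and for each edge $e:i\to j$ an element $a_e\in A$, which defines the $A$-linear map $Ax_i\to Ax_j$, $x_i\mapsto a_ex_j$, such that $x\le y$ if and only if $x=0$ or $x=c\,\gamma(y)$ for some $c\in A^+$ and some composite $\gamma$ of such maps along a (possibly empty) path of $Q$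 that begins at a vertex $i$ with $y\in Ax_i$. The statement remains true if condition 4 is replaced by the following two conditions together, where $K_A$ is the monoid of fractions of $A$ (all non-zero elements inverted) and $M\otimes_AK_A$ is ordered by $z\le z'$ if and only if $z=m/s$ and $z'=m'/s$ for some $m\le m'$ in $M$ and $0\neq s\in A$: * (4a) $M$ is a lower submodule of $M\otimes_AK_A$: the canonical map $M\to M\otimes_AK_A$ is injective, the order of $M$ is the one induced from $M\otimes_AK_A$, and the image of $M$ is a lower subset; * (4b) $(M,\le)$ is finitely presented, that is, compact as an object of $\mathbf{PO}\mathrm{Mod}_A$: $\mathrm{Hom}(M,-)$ commutes with filtered colimits. -/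

import Mathlib

open CategoryTheory

universe u

/-! ### `𝔽₁`-algebra pairs, and domains -/

/-- An `𝔽₁`-algebra pair `(A; A⁺)` with `A⁺ ⊆ A`: here `A` is a commutative monoid with zero and
`A⁺` (the field `plus`) is a submonoid containing zero. -/
structure F1Pair (A : Type u) [CommMonoidWithZero A] where
  plus : Submonoid A
  zero_mem : (0 : A) ∈ plus

/-- `(A; A⁺)` is an `𝔽₁`-domain with `A⁺` sharp. -/
structure F1Pair.IsDomain {A : Type u} [CommMonoidWithZero A] (P : F1Pair A) : Prop where
  /-- the monoids are not the one-element monoid with zero -/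
  nontrivial : (0 : A) ≠ 1
  /-- `1` is the only invertible element of `A⁺` -/
  sharp : ∀ a ∈ P.plus, ∀ b ∈ P.plus, a * b = 1 → a = 1
  /-- `A⁺ ∖ 0` is a cancellative monoid -/
  cancel : ∀ a ∈ P.plus, ∀ b ∈ P.plus, ∀ c ∈ P.plus, a ≠ 0 → a * b = a * c → b = c
  /-- `A` is a localisation of `A⁺` -/
  localisation : ∃ S : Submonoid P.plus, S.IsLocalizationMap (Subtype.val : P.plus → A)
  /-- `A⁺` is integrally closed in `A` -/
  integrallyClosed : ∀ (f : A) (n : ℕ), 0 < n → f ^ n ∈ P.plus → f ∈ P.plus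

/-! ### The fractional ideal semiring `𝔹[A; A⁺]` -/

/-- A finite (that is, finitely generated) `A⁺`-submodule of `A`. All modules over monoids with
zero are pointed, so that a submodule contains `0`. -/
structure FracIdeal {A : Type u} [CommMonoidWithZero A] (P : F1Pair A) where
  carrier : Set A
  zero_mem : (0 : A) ∈ carrier
  mul_mem : ∀ c ∈ P.plus, ∀ x ∈ carrier, c * x ∈ carrier
  fg : ∃ F : Finset A, (F : Set A) ⊆ carrier ∧
    ∀ x ∈ carrier, x = 0 ∨ ∃ c ∈ P.plus, ∃ f ∈ F, x = c * f

namespace FracIdeal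

variable {A : Type u} [CommMonoidWithZero A] {P : F1Pair A}

@[ext] theorem ext {D E : FracIdeal P} (h : ∀ x, x ∈ D.carrier ↔ x ∈ E.carrier) : D = E := by
  obtain ⟨d, _, _, _⟩ := D
  obtain ⟨e, _, _, _⟩ := E
  have : d = e := Set.ext h
  subst this
  rfl

/-- The principal fractional ideal `A⁺a`; this is the universal valuation `A → 𝔹[A; A⁺]`. -/
def log (P : F1Pair A) (a : A) : FracIdeal P where
  carrier := {x | ∃ c ∈ P.plus, x = c * a}
  zero_mem := ⟨0, P.zero_mem, by simp⟩
  mul_mem := by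
    rintro c hc _ ⟨d, hd, rfl⟩
    exact ⟨c * d, P.plus.mul_mem hc hd, by rw [mul_assoc]⟩
  fg := ⟨{a}, by
    intro x hx
    simp only [Finset.coe_singleton, Set.mem_singleton_iff] at hx
    exact ⟨1, P.plus.one_mem, by simp [hx]⟩, by
    rintro x ⟨c, hc, rfl⟩
    exact Or.inr ⟨c, hc, a, by simp, rfl⟩⟩

instance : Zero (FracIdeal P) where
  zero :=
    { carrier := {0}
      zero_mem := rfl
      mul_mem := by rintro c _ x rfl; simp
      fg := ⟨∅, by simp, fun x hx => Or.inl hx⟩ }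

instance : One (FracIdeal P) where
  one := log P 1

/-- The sum of two finite submodules is their union. -/
instance : Add (FracIdeal P) where
  add D E :=
    { carrier := D.carrier ∪ E.carrier
      zero_mem := Or.inl D.zero_mem
      mul_mem := by
        rintro c hc x (hx | hx)
        · exact Or.inl (D.mul_mem c hc x hx)
        · exact Or.inr (E.mul_mem c hc x hx)
      fg := by
        classical
        obtain ⟨F, hF, hF'⟩ := D.fg
        obtain ⟨G, hG, hG'⟩ := E.fg
        refine ⟨F ∪ G, ?_, ?_⟩
        · rw [Finset.coe_union]
          exact Set.union_subset_union hF hG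
        · rintro x (hx | hx)
          · rcases hF' x hx with h | ⟨c, hc, f, hf, h⟩
            · exact Or.inl h
            · exact Or.inr ⟨c, hc, f, Finset.mem_union_left _ hf, h⟩
          · rcases hG' x hx with h | ⟨c, hc, f, hf, h⟩
            · exact Or.inl h
            · exact Or.inr ⟨c, hc, f, Finset.mem_union_right _ hf, h⟩ }

/-- The product of two finite submodules is the set of products of their elements. -/
instance : Mul (FracIdeal P) where
  mul D E :=
    { carrier := {x | ∃ d ∈ D.carrier, ∃ e ∈ E.carrier, x = d * e}
      zero_mem := ⟨0, D.zero_mem, 0, E.zero_mem, by simp⟩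
      mul_mem := by
        rintro c hc _ ⟨d, hd, e, he, rfl⟩
        exact ⟨c * d, D.mul_mem c hc d hd, e, he, by rw [mul_assoc]⟩
      fg := by
        classical
        obtain ⟨F, hF, hF'⟩ := D.fg
        obtain ⟨G, hG, hG'⟩ := E.fg
        refine ⟨(F ×ˢ G).image fun p => p.1 * p.2, ?_, ?_⟩
        · intro x hx
          simp only [Finset.coe_image, Set.mem_image, Finset.mem_coe, Finset.mem_product] at hx
          obtain ⟨p, ⟨h1, h2⟩, rfl⟩ := hx
          exact ⟨p.1, hF h1, p.2, hG h2, rfl⟩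
        · rintro _ ⟨d, hd, e, he, rfl⟩
          rcases hF' d hd with rfl | ⟨c, hc, f, hf, rfl⟩
          · left; simp
          rcases hG' e he with rfl | ⟨c', hc', g, hg, rfl⟩
          · left; simp
          refine Or.inr ⟨c * c', P.plus.mul_mem hc hc', f * g, ?_, mul_mul_mul_comm _ _ _ _⟩
          exact Finset.mem_image.2 ⟨(f, g), Finset.mem_product.2 ⟨hf, hg⟩, rfl⟩ }

theorem mem_zero {x : A} : x ∈ (0 : FracIdeal P).carrier ↔ x = 0 := Iff.rfl

theorem mem_log {a x : A} : x ∈ (log P a).carrier ↔ ∃ c ∈ P.plus, x = c * a := Iff.rfl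

theorem mem_add {D E : FracIdeal P} {x : A} :
    x ∈ (D + E).carrier ↔ x ∈ D.carrier ∨ x ∈ E.carrier := Iff.rfl

theorem mem_mul {D E : FracIdeal P} {x : A} :
    x ∈ (D * E).carrier ↔ ∃ d ∈ D.carrier, ∃ e ∈ E.carrier, x = d * e := Iff.rfl

theorem log_one : log P 1 = 1 := rfl

theorem log_zero : log P 0 = 0 := by
  ext x
  rw [mem_log, mem_zero]
  exact ⟨by rintro ⟨c, _, rfl⟩; simp, by rintro rfl; exact ⟨0, P.zero_mem, by simp⟩⟩

theorem log_mul (a b : A) : log P (a * b) = log P a * log P b := by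
  ext x
  simp only [mem_mul, mem_log]
  constructor
  · rintro ⟨c, hc, rfl⟩
    exact ⟨c * a, ⟨c, hc, rfl⟩, b, ⟨1, P.plus.one_mem, by simp⟩, by rw [mul_assoc]⟩
  · rintro ⟨_, ⟨c, hc, rfl⟩, _, ⟨d, hd, rfl⟩, rfl⟩
    exact ⟨c * d, P.plus.mul_mem hc hd, mul_mul_mul_comm _ _ _ _⟩

protected theorem mul_comm' (D E : FracIdeal P) : D * E = E * D := by
  ext x
  simp only [mem_mul]
  constructor <;>
  · rintro ⟨d, hd, e, he, rfl⟩
    exact ⟨e, he, d, hd, mul_comm _ _⟩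

protected theorem one_mul' (D : FracIdeal P) : 1 * D = D := by
  ext x
  rw [← log_one]
  simp only [mem_mul, mem_log]
  constructor
  · rintro ⟨_, ⟨c, hc, rfl⟩, d, hd, rfl⟩
    rw [mul_one]
    exact D.mul_mem c hc d hd
  · intro hx
    exact ⟨1, ⟨1, P.plus.one_mem, by simp⟩, x, hx, by simp⟩

protected theorem zero_mul' (D : FracIdeal P) : 0 * D = 0 := by
  ext x
  simp only [mem_mul, mem_zero]
  constructor
  · rintro ⟨_, rfl, d, _, rfl⟩
    simp
  · rintro rfl
    exact ⟨0, rfl, 0, D.zero_mem, by simp⟩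

protected theorem mul_add' (D E F : FracIdeal P) : D * (E + F) = D * E + D * F := by
  ext x
  simp only [mem_mul, mem_add]
  constructor
  · rintro ⟨d, hd, e, he | he, rfl⟩
    · exact Or.inl ⟨d, hd, e, he, rfl⟩
    · exact Or.inr ⟨d, hd, e, he, rfl⟩
  · rintro (⟨d, hd, e, he, rfl⟩ | ⟨d, hd, e, he, rfl⟩)
    · exact ⟨d, hd, e, Or.inl he, rfl⟩
    · exact ⟨d, hd, e, Or.inr he, rfl⟩

/-- The semiring `𝔹[A; A⁺]`. -/
instance : CommSemiring (FracIdeal P) where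
  add_assoc D E F := by ext x; simp only [mem_add, or_assoc]
  zero_add D := by
    ext x
    simp only [mem_add, mem_zero]
    exact ⟨by rintro (rfl | h); exacts [D.zero_mem, h], Or.inr⟩
  add_zero D := by
    ext x
    simp only [mem_add, mem_zero]
    exact ⟨by rintro (h | rfl); exacts [h, D.zero_mem], Or.inl⟩
  add_comm D E := by ext x; simp only [mem_add, or_comm]
  nsmul := nsmulRec
  mul_assoc D E F := by
    ext x
    simp only [mem_mul]
    constructor
    · rintro ⟨_, ⟨d, hd, e, he, rfl⟩, f, hf, rfl⟩
      exact ⟨d, hd, e * f, ⟨e, he, f, hf, rfl⟩, mul_assoc _ _ _⟩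
    · rintro ⟨d, hd, _, ⟨e, he, f, hf, rfl⟩, rfl⟩
      exact ⟨d * e, ⟨d, hd, e, he, rfl⟩, f, hf, (mul_assoc _ _ _).symm⟩
  one_mul := FracIdeal.one_mul'
  mul_one D := by rw [FracIdeal.mul_comm', FracIdeal.one_mul']
  mul_comm := FracIdeal.mul_comm'
  zero_mul := FracIdeal.zero_mul'
  mul_zero D := by rw [FracIdeal.mul_comm', FracIdeal.zero_mul']
  left_distrib := FracIdeal.mul_add'
  right_distrib D E F := by
    rw [FracIdeal.mul_comm', FracIdeal.mul_add', FracIdeal.mul_comm' F D, FracIdeal.mul_comm' F E]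

theorem add_self (D : FracIdeal P) : D + D = D := by
  ext x
  simp only [mem_add, or_self]

/-- `log f ∨ log g = log g` whenever `f ∈ A⁺g`. -/
theorem log_add_log {f g : A} (h : ∃ c ∈ P.plus, f = c * g) : log P f + log P g = log P g := by
  obtain ⟨c, hc, rfl⟩ := h
  ext x
  simp only [mem_add, mem_log]
  refine ⟨?_, Or.inr⟩
  rintro (⟨d, hd, rfl⟩ | h)
  · exact ⟨d * c, P.plus.mul_mem hd hc, by rw [mul_assoc]⟩
  · exact h

end FracIdeal

/-! ### Partially ordered modules -/

/-- A partially ordered module over `(A; A⁺)`: a pointed `A`-module with a partial order such that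
`f v ≤ g v` for `f ∈ A⁺g`, and `v ≤ w` implies `f v ≤ f w`. (As `0 ∈ A⁺`, the point `0` is
automatically the minimum.) -/
structure POMod {A : Type u} [CommMonoidWithZero A] (P : F1Pair A) : Type (u + 1) where
  carrier : Type u
  [zero : Zero carrier]
  [action : MulActionWithZero A carrier]
  [order : PartialOrder carrier]
  smul_le_smul_left : ∀ (f g : A) (v : carrier), (∃ c ∈ P.plus, f = c * g) → f • v ≤ g • v
  smul_le_smul_right : ∀ (f : A) (v w : carrier), v ≤ w → f • v ≤ f • w

namespace POMod

variable {A : Type u} [CommMonoidWithZero A] {P : F1Pair A}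

instance : CoeSort (POMod P) (Type u) := ⟨POMod.carrier⟩

attribute [instance] POMod.zero POMod.action POMod.order

/-- Morphisms of partially ordered modules: monotone `A`-linear pointed maps. -/
@[ext] structure Hom (M N : POMod P) : Type u where
  toFun : M → N
  map_zero : toFun 0 = 0
  map_smul : ∀ (a : A) (x : M), toFun (a • x) = a • toFun x
  monotone : Monotone toFun

/-- The category of partially ordered modules over `(A; A⁺)`. -/
instance : Category.{u} (POMod P) where
  Hom := Hom
  id M := ⟨id, rfl, fun _ _ => rfl, monotone_id⟩
  comp f g := ⟨g.toFun ∘ f.toFun, by simp [f.map_zero, g.map_zero],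
    fun a x => by simp [f.map_smul, g.map_smul], g.monotone.comp f.monotone⟩

/-- The family `b` is a basis of the `A`-module `M`: it identifies `M` with the coproduct (wedge
sum) of copies of `A` indexed by `I`. The cyclic factors of `M` are then the `A • b i`. -/
structure IsBasis (M : POMod P) {I : Type u} (b : I → M) : Prop where
  smul_ne_zero : ∀ (i : I) (a : A), a ≠ 0 → a • b i ≠ 0
  injective : ∀ (i j : I) (a a' : A), a ≠ 0 → a • b i = a' • b j → i = j ∧ a = a'
  generates : ∀ x : M, x ≠ 0 → ∃ (i : I) (a : A), x = a • b i

/-- `M` is free as an `A`-module. -/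
def IsFree (M : POMod P) : Prop :=
  ∃ (I : Type u) (b : I → M), M.IsBasis b

/-- The order of the free module `M` is non-degenerate: its restriction to each cyclic factor is
the `A⁺`-divisibility order. -/
def IsNondegenerate (M : POMod P) : Prop :=
  ∀ (I : Type u) (b : I → M), M.IsBasis b →
    ∀ (i : I) (x y : M), (∃ a : A, x = a • b i) → (∃ a : A, y = a • b i) →
      (x ≤ y ↔ ∃ c ∈ P.plus, x = c • y)

/-- The element of `A` by which a path of a quiver acts, if each edge acts by an element of `A`. -/
def pathWeight {I : Type u} [Quiver.{u + 1} I] (w : ∀ {i j : I}, (i ⟶ j) → A) :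
    ∀ {i j : I}, Quiver.Path i j → A
  | _, _, .nil => 1
  | _, _, .cons p e => w e * pathWeight w p

/-- The relation `∃ γ ∈ Path_{A⁺}(Q), x = γ y` defined by a representation of a quiver `Q` on a free
module with basis `b` indexed by the vertices of `Q`, where an edge `e : i ⟶ j` acts as the linear
map `A • b i → A • b j` that takes `b i` to `w e • b j`. The elements of the `A⁺`-linear path
category are the `c • γ` with `c ∈ A⁺` and `γ` a path, and the zero maps. -/
def QuiverLE {M : POMod P} {I : Type u} [Quiver.{u + 1} I] (b : I → M)
    (w : ∀ {i j : I}, (i ⟶ j) → A) (x y : M) : Prop :=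
  x = 0 ∨ ∃ (i j : I) (γ : Quiver.Path i j) (c a : A), c ∈ P.plus ∧
    y = a • b i ∧ x = (c * pathWeight w γ * a) • b j

/-- The order of the free module `M` is presented by a quiver with finitely many vertices and
edges. -/
def IsPresentedByFiniteQuiver (M : POMod P) : Prop :=
  ∃ (I : Type u) (b : I → M) (_ : Quiver.{u + 1} I) (w : ∀ {i j : I}, (i ⟶ j) → A),
    M.IsBasis b ∧ Finite I ∧ (∀ i j : I, Finite (i ⟶ j)) ∧
      ∀ x y : M, x ≤ y ↔ QuiverLE b w x y

/-- The module `M ⊗_A K_A`, as the module of fractions `m / s`, with `s` a non-zero-divisor of `A`;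
when `A` is a domain, these are just the non-zero elements. -/
abbrev Frac (M : POMod P) : Type u :=
  OreLocalization (nonZeroDivisors A) M

/-- The order of the partially ordered module `M ⊗_A K_A`: fractions are compared by comparing
numerators over some common denominator. -/
def fracLE (M : POMod P) (z z' : M.Frac) : Prop :=
  ∃ (m m' : M) (s : nonZeroDivisors A),
    m ≤ m' ∧ z = OreLocalization.oreDiv m s ∧ z' = OreLocalization.oreDiv m' s

/-- The canonical map `M → M ⊗_A K_A`. -/
def toFrac (M : POMod P) (m : M) : M.Frac :=
  OreLocalization.oreDiv m 1

/-- `M` is a lower submodule of `M ⊗_A K_A`: the canonical map is injective and identifies `M`,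
as a partially ordered module, with a lower subset of `M ⊗_A K_A`. -/
structure IsLowerInFrac (M : POMod P) : Prop where
  injective : Function.Injective M.toFrac
  le_iff : ∀ m m' : M, M.fracLE (M.toFrac m) (M.toFrac m') ↔ m ≤ m'
  lower : ∀ (z : M.Frac) (m : M), M.fracLE z (M.toFrac m) → ∃ m' : M, z = M.toFrac m'

end POMod

/-! ### Primitive elements of a `𝔹[A; A⁺]`-module -/

section Primitives

variable {μ : Type u} [AddCommMonoid μ]

/-- The order of an idempotent monoid (written additively): `x ≤ y` means `x ∨ y = y`. -/
def JoinLE (x y : μ) : Prop := x + y = y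

/-- `x` is primitive: it belongs to every finite set of which it is the join (sum). As the empty
join is the minimum `0`, the latter is not primitive. -/
def IsPrimitive (x : μ) : Prop :=
  ∀ s : Finset μ, ∑ y ∈ s, y = x → x ∈ s

/-- Every element is in a unique way the join of a finite set of primitive elements without order
relations among different elements. -/
def HasUniqueIrredundantDecompositions (μ : Type u) [AddCommMonoid μ] : Prop :=
  ∀ x : μ, ∃! s : Finset μ, (∀ y ∈ s, IsPrimitive y) ∧
    (∀ y ∈ s, ∀ z ∈ s, JoinLE y z → y = z) ∧ ∑ y ∈ s, y = x

variable {A : Type u} [CommMonoidWithZero A] (P : F1Pair A)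
variable (μ) [Module (FracIdeal P) μ]

/-- The primitive elements of `μ`, together with `0`, are an `A`-submodule of `μ`; here `a ∈ A` acts
on `μ` by the principal fractional ideal `A⁺a`. -/
def PrimIsSubmodule : Prop :=
  ∀ (a : A) (x : μ), IsPrimitive x →
    FracIdeal.log P a • x = 0 ∨ IsPrimitive (FracIdeal.log P a • x)

variable {P μ}

theorem add_self_of_fracIdeal_module (P : F1Pair A) [Module (FracIdeal P) μ] (x : μ) :
    x + x = x := by
  have h : ((1 : FracIdeal P) + 1) • x = (1 : FracIdeal P) • x := by rw [FracIdeal.add_self]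
  simpa only [add_smul, one_smul] using h

/-- The set of primitive elements of `μ` together with `0`, as a partially ordered module over
`(A; A⁺)` with the order and the action induced from `μ`. -/
def primPOMod (h : PrimIsSubmodule μ P) : POMod P :=
  letI : Zero {x : μ // x = 0 ∨ IsPrimitive x} := ⟨⟨0, Or.inl rfl⟩⟩
  { carrier := {x : μ // x = 0 ∨ IsPrimitive x}
    action :=
      { smul := fun a x => ⟨FracIdeal.log P a • x.1, by
          rcases x.2 with hx | hx
          · left; rw [hx, smul_zero]
          · exact h a x.1 hx⟩
        one_smul := fun x => Subtype.ext (by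
          change FracIdeal.log P 1 • x.1 = x.1
          rw [FracIdeal.log_one, one_smul])
        mul_smul := fun a b x => Subtype.ext (by
          change FracIdeal.log P (a * b) • x.1 = FracIdeal.log P a • FracIdeal.log P b • x.1
          rw [FracIdeal.log_mul, mul_smul])
        smul_zero := fun a => Subtype.ext (smul_zero (FracIdeal.log P a))
        zero_smul := fun x => Subtype.ext (by
          change FracIdeal.log P 0 • x.1 = 0
          rw [FracIdeal.log_zero, zero_smul]) }
    order :=
      { le := fun x y => JoinLE x.1 y.1
        le_refl := fun x => add_self_of_fracIdeal_module P x.1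
        le_trans := fun x y z (hxy : x.1 + y.1 = y.1) (hyz : y.1 + z.1 = z.1) => by
          change x.1 + z.1 = z.1
          rw [← hyz, ← add_assoc, hxy]
        le_antisymm := fun x y (hxy : x.1 + y.1 = y.1) (hyx : y.1 + x.1 = x.1) =>
          Subtype.ext (by rw [← hyx, add_comm, hxy]) }
    smul_le_smul_left := fun f g v hfg => by
      change FracIdeal.log P f • v.1 + FracIdeal.log P g • v.1 = FracIdeal.log P g • v.1
      rw [← add_smul, FracIdeal.log_add_log hfg]
    smul_le_smul_right := fun f v w (hvw : v.1 + w.1 = w.1) => by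
      change FracIdeal.log P f • v.1 + FracIdeal.log P f • w.1 = FracIdeal.log P f • w.1
      rw [← smul_add, hvw] }

end Primitives

/-! ### Cancellation in `𝔽₁`-domains -/

namespace F1Pair.IsDomain

variable {A : Type u} [CommMonoidWithZero A] {P : F1Pair A}

/-! Both lists of conditions are compared with one notion, the matrix presentation
`POMod.IsPresentedBy`: a finite basis `b` and finitely generated fractional ideals `E i j` such that
`a • b i ≤ a' • b j` exactly when `a ∈ a' E i j`.

A finite projective `μ` is a retract of a finite free module, so it has generators `x i` and
coordinates `ι X i`. Sums of fractional ideals are unions; hence a nonzero element of a coordinate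
of a join already lies in that coordinate of one of the terms. If `1 ∈ ι (x i) i`, then `a ∈ ι X i`
means `a x_i ≤ X`, and the nonzero multiples of `x i` are join-prime. A finiteness argument
(`exists_reflexive_above`) shows that these `x i` generate. A generating set of primes gives unique
decompositions. Integral closedness puts the diagonal ideals inside `A⁺` (`mem_plus_of_pow_mem`),
and sharpness then makes the primitives free over `A`. Conversely, unique decompositions make
primitives prime, so `X ↦ {a | a x_i ≤ X}` is linear with finitely generated values, and these maps
split the surjection given by the basis.

Generators of the `E i j` are the edges of a finite quiver. Conversely, non-degeneracy puts the
weights of loops in `A⁺`, so the finitely many paths without repeated vertices generate the `E i j`.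

For the variant with fractions, lowerness allows `a • b i ≤ a' • b j` to be divided by `a'`, while
compactness gives a finite basis and finitely many generating inequalities; these become edges.
Conversely, a map out of a module with a matrix presentation is a finite tuple subject to finitely
many inequalities, so it descends to a stage of any filtered colimit. -/

theorem mul_left_cancel (hP : P.IsDomain) {a b c : A} (ha : a ≠ 0) (h : a * b = a * c) :
    b = c := by
  obtain ⟨S, hS⟩ := hP.localisation
  obtain ⟨⟨a', s⟩, hs⟩ := hS.surj a
  obtain ⟨⟨b', t⟩, ht⟩ := hS.surj b
  obtain ⟨⟨c', r⟩, hr⟩ := hS.surj c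
  have us := hS.map_units s
  have ut := hS.map_units t
  have ur := hS.map_units r
  simp only at hs ht hr us ut ur
  have ha' : (a' : A) ≠ 0 := by
    rw [← hs]
    intro h0
    exact ha (us.mul_left_eq_zero.1 h0)
  have key := hP.cancel a' a'.2 (b' * r.1) (P.plus.mul_mem b'.2 r.1.2) (c' * t.1)
    (P.plus.mul_mem c'.2 t.1.2) ha' (by
      rw [← hs, ← ht, ← hr]
      calc a * s.1 * (b * t.1 * r.1) = (a * b) * (s.1 * t.1 * r.1) := by ac_rfl
        _ = a * c * (s.1 * t.1 * r.1) := by rw [h]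
        _ = _ := by ac_rfl)
  rw [← ht, ← hr] at key
  refine (ut.mul ur).mul_right_cancel ?_
  calc b * (t.1 * r.1) = b * t.1 * r.1 := by ac_rfl
    _ = c * r.1 * t.1 := key
    _ = _ := by ac_rfl

theorem mul_ne_zero (hP : P.IsDomain) {a b : A} (ha : a ≠ 0) (hb : b ≠ 0) : a * b ≠ 0 := by
  intro h
  exact hb (hP.mul_left_cancel ha (by rw [h, mul_zero]))

theorem mem_nonZeroDivisors (hP : P.IsDomain) {a : A} (ha : a ≠ 0) : a ∈ nonZeroDivisors A := by
  rw [mem_nonZeroDivisors_iff_right]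
  intro x hx
  by_contra h
  exact hP.mul_ne_zero h ha hx

theorem ne_zero_of_mem_nonZeroDivisors (hP : P.IsDomain) {a : A} (ha : a ∈ nonZeroDivisors A) :
    a ≠ 0 := by
  rintro rfl
  rw [mem_nonZeroDivisors_iff_right] at ha
  exact hP.nontrivial (ha 1 (by simp)).symm

/-- A finite `A⁺`-submodule of `A` that is closed under powers of `f` forces `f ∈ A⁺`. -/
theorem mem_plus_of_pow_mem (hP : P.IsDomain) {D : FracIdeal P} (h1 : 1 ∈ D.carrier)
    (hmul : ∀ a ∈ D.carrier, ∀ b ∈ D.carrier, a * b ∈ D.carrier) {f : A} (hf : f ∈ D.carrier) :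
    f ∈ P.plus := by
  obtain ⟨F, hF, hgen⟩ := D.fg
  by_cases hf0 : f = 0
  · rw [hf0]; exact P.zero_mem
  have hpow : ∀ n : ℕ, f ^ n ≠ 0 := by
    intro n
    induction n with
    | zero => rw [pow_zero]; exact hP.nontrivial.symm
    | succ n ih => rw [pow_succ]; exact hP.mul_ne_zero ih hf0
  let Z : Set A := {g | g ∈ F ∧ g ≠ 0}
  have hZ : Finite Z := (F.finite_toSet.subset fun g hg => hg.1).to_subtype
  -- Multiplication by `f` sends each nonzero generator to an `A⁺`-multiple of another one; this
  -- yields a self-map `σ` of the finite set `Z`.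
  have step : ∀ g : Z, ∃ g' : Z, ∃ c ∈ P.plus, f * g = c * g' := by
    rintro ⟨g, hg, hg0⟩
    have hne := hP.mul_ne_zero hf0 hg0
    rcases hgen (f * g) (hmul _ hf _ (hF hg)) with h | ⟨c, hc, g', hg', h⟩
    · exact absurd h hne
    · refine ⟨⟨g', hg', ?_⟩, c, hc, h⟩
      rintro rfl
      rw [mul_zero] at h
      exact hne h
  choose σ hσ using step
  have iter : ∀ (n : ℕ) (g : Z), ∃ c ∈ P.plus, f ^ n * g = c * (σ^[n] g : Z) := by
    intro n
    induction n with
    | zero => intro g; exact ⟨1, P.plus.one_mem, by simp⟩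
    | succ n ih =>
      intro g
      obtain ⟨c, hc, h⟩ := hσ g
      obtain ⟨d, hd, h'⟩ := ih (σ g)
      refine ⟨c * d, P.plus.mul_mem hc hd, ?_⟩
      rw [Function.iterate_succ_apply, mul_assoc, ← h', pow_succ, mul_assoc, h]
      ac_rfl
  obtain ⟨g₀⟩ : Nonempty Z := by
    rcases hgen 1 h1 with h | ⟨c, _, g, hg, h⟩
    · exact absurd h.symm hP.nontrivial
    · refine ⟨⟨g, hg, ?_⟩⟩
      rintro rfl
      rw [mul_zero] at h
      exact hP.nontrivial h.symm
  -- A repetition in the `σ`-orbit gives `f ^ (n - m) * g = c * g` with `c ∈ A⁺`; cancel `g` and use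
  -- integral closedness.
  have main : ∀ m n : ℕ, m < n → σ^[m] g₀ = σ^[n] g₀ → f ∈ P.plus := by
    intro m n hmn h
    obtain ⟨c, hc, h'⟩ := iter (n - m) (σ^[m] g₀)
    rw [← Function.iterate_add_apply, Nat.sub_add_cancel hmn.le, ← h, mul_comm, mul_comm c] at h'
    have := hP.mul_left_cancel (σ^[m] g₀).2.2 h'
    exact hP.integrallyClosed f (n - m) (Nat.sub_pos_of_lt hmn) (this ▸ hc)
  obtain ⟨m, n, hne, h⟩ := Finite.exists_ne_map_eq_of_infinite fun n : ℕ => σ^[n] g₀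
  rcases lt_or_gt_of_ne hne with hl | hl
  · exact main m n hl h
  · exact main n m hl h.symm

end F1Pair.IsDomain

/-! ### Finite sums of fractional ideals -/

namespace FracIdeal

variable {A : Type u} [CommMonoidWithZero A] {P : F1Pair A}

theorem self_mem_log (a : A) : a ∈ (log P a).carrier := ⟨1, P.plus.one_mem, (one_mul a).symm⟩

/-- Sums are unions, which is the source of all primality below; the disjunct `x = 0` accounts for
the empty sum. -/
theorem mem_sum {ι : Type*} (s : Finset ι) (D : ι → FracIdeal P) {x : A} :
    x ∈ (∑ i ∈ s, D i).carrier ↔ x = 0 ∨ ∃ i ∈ s, x ∈ (D i).carrier := by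
  classical
  induction s using Finset.induction_on with
  | empty => simp [mem_zero]
  | insert i s hi ih =>
    rw [Finset.sum_insert hi, mem_add, ih]
    simp only [Finset.mem_insert, exists_eq_or_imp]
    tauto

theorem log_add_of_mem {D : FracIdeal P} {a : A} (ha : a ∈ D.carrier) : log P a + D = D := by
  ext x
  rw [mem_add]
  refine ⟨?_, Or.inr⟩
  rintro (⟨c, hc, rfl⟩ | h)
  · exact D.mul_mem c hc a ha
  · exact h

theorem exists_eq_sum_log (D : FracIdeal P) : ∃ F : Finset A, D = ∑ f ∈ F, log P f := by
  obtain ⟨F, hF, hgen⟩ := D.fg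
  refine ⟨F, ext fun x => ?_⟩
  rw [mem_sum]
  constructor
  · intro hx
    rcases hgen x hx with h | ⟨c, hc, f, hf, h⟩
    · exact Or.inl h
    · exact Or.inr ⟨f, hf, c, hc, h⟩
  · rintro (rfl | ⟨f, hf, c, hc, rfl⟩)
    · exact D.zero_mem
    · exact D.mul_mem c hc f (hF hf)

end FracIdeal

/-! ### Primitive and prime elements of idempotent monoids -/

section Semilattice

variable {μ : Type u} [AddCommMonoid μ]

theorem JoinLE.trans {x y z : μ} (hxy : JoinLE x y) (hyz : JoinLE y z) : JoinLE x z := by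
  unfold JoinLE at *
  rw [← hyz, ← add_assoc, hxy]

theorem JoinLE.antisymm {x y : μ} (hxy : JoinLE x y) (hyx : JoinLE y x) : x = y := by
  unfold JoinLE at *
  rw [← hyx, add_comm, hxy]

theorem JoinLE.zero (x : μ) : JoinLE 0 x := zero_add x

theorem JoinLE.add {x y z : μ} (hx : JoinLE x z) (hy : JoinLE y z) : JoinLE (x + y) z := by
  unfold JoinLE at *
  rw [add_assoc, hy, hx]

theorem JoinLE.sum {ι : Type*} {s : Finset ι} {f : ι → μ} {z : μ}
    (h : ∀ i ∈ s, JoinLE (f i) z) : JoinLE (∑ i ∈ s, f i) z := by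
  classical
  induction s using Finset.induction_on with
  | empty => exact JoinLE.zero z
  | insert i s hi ih =>
    rw [Finset.sum_insert hi]
    exact (h i (by simp)).add (ih fun j hj => h j (by simp [hj]))

theorem JoinLE.left (hμ : ∀ x : μ, x + x = x) (x y : μ) : JoinLE x (x + y) := by
  unfold JoinLE
  rw [← add_assoc, hμ]

theorem JoinLE.right (hμ : ∀ x : μ, x + x = x) (x y : μ) : JoinLE y (x + y) := by
  rw [add_comm]
  exact JoinLE.left hμ y x

theorem JoinLE.le_sum (hμ : ∀ x : μ, x + x = x) {ι : Type*} {s : Finset ι} (f : ι → μ) {i : ι}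
    (hi : i ∈ s) : JoinLE (f i) (∑ j ∈ s, f j) := by
  classical
  rw [← Finset.add_sum_erase s f hi]
  exact JoinLE.left hμ _ _

/-- `p` is prime: it lies below a finite join only if it lies below one of its terms. -/
def IsJoinPrime (p : μ) : Prop :=
  ∀ s : Finset μ, JoinLE p (∑ y ∈ s, y) → ∃ y ∈ s, JoinLE p y

theorem IsJoinPrime.isPrimitive (hμ : ∀ x : μ, x + x = x) {p : μ} (hp : IsJoinPrime p) :
    IsPrimitive p := by
  intro s hs
  obtain ⟨y, hy, hpy⟩ := hp s (by rw [hs]; exact hμ p)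
  have : JoinLE y p := by
    rw [← hs]
    exact JoinLE.le_sum hμ (fun y => y) hy
  rw [hpy.antisymm this]
  exact hy

/-- Every finite set of elements can be made irredundant without changing its join. -/
theorem exists_irredundant_subset (hμ : ∀ x : μ, x + x = x) (s : Finset μ) :
    ∃ t ⊆ s, (∀ y ∈ t, ∀ z ∈ t, JoinLE y z → y = z) ∧ ∑ y ∈ t, y = ∑ y ∈ s, y ∧
      ∀ y ∈ s, ∃ z ∈ t, JoinLE y z := by
  classical
  induction s using Finset.strongInduction with
  | H s ih =>
    by_cases h : ∀ y ∈ s, ∀ z ∈ s, JoinLE y z → y = z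
    · exact ⟨s, subset_rfl, h, rfl, fun y hy => ⟨y, hy, hμ y⟩⟩
    · push Not at h
      obtain ⟨y, hy, z, hz, hyz, hne⟩ := h
      have hz' : z ∈ s.erase y := Finset.mem_erase.2 ⟨hne.symm, hz⟩
      obtain ⟨t, hts, hanti, hsum, hbelow⟩ := ih (s.erase y) (Finset.erase_ssubset hy)
      refine ⟨t, hts.trans (Finset.erase_subset _ _), hanti, ?_, ?_⟩
      · rw [hsum, ← Finset.add_sum_erase s (fun y => y) hy]
        exact (hyz.trans (JoinLE.le_sum hμ (fun y => y) hz')).symm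
      · intro w hw
        by_cases hwy : w = y
        · subst hwy
          obtain ⟨v, hv, hzv⟩ := hbelow z hz'
          exact ⟨v, hv, hyz.trans hzv⟩
        · exact hbelow w (Finset.mem_erase.2 ⟨hwy, hw⟩)

/-- In an idempotent monoid generated by a set of primes, these are exactly the primitive
elements, and irredundant primitive decompositions exist uniquely. -/
theorem uniqueDecompositions_of_primes (hμ : ∀ x : μ, x + x = x) (S : Set μ)
    (hprime : ∀ p ∈ S, IsJoinPrime p)
    (hgen : ∀ x : μ, ∃ s : Finset μ, (∀ y ∈ s, y ∈ S) ∧ ∑ y ∈ s, y = x) :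
    (∀ p : μ, IsPrimitive p ↔ p ∈ S) ∧ HasUniqueIrredundantDecompositions μ := by
  have hS : ∀ p : μ, IsPrimitive p ↔ p ∈ S := by
    refine fun p => ⟨fun hp => ?_, fun hp => (hprime p hp).isPrimitive hμ⟩
    obtain ⟨s, hs, hsum⟩ := hgen p
    exact hs p (hp s hsum)
  refine ⟨hS, fun x => ?_⟩
  obtain ⟨s, hs, hsum⟩ := hgen x
  obtain ⟨t, hts, hanti, hsum', -⟩ := exists_irredundant_subset hμ s
  refine ⟨t, ⟨fun y hy => (hS y).2 (hs y (hts hy)), hanti, hsum'.trans hsum⟩, ?_⟩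
  -- By primality `y ∈ u` lies below some `z ∈ v`, which lies below some `w ∈ u`; irredundance of
  -- `u` gives `y = w`, hence `y = z`.
  have aux : ∀ u v : Finset μ, (∀ y ∈ u, IsPrimitive y) → (∀ y ∈ v, IsPrimitive y) →
      (∀ y ∈ u, ∀ z ∈ u, JoinLE y z → y = z) → ∑ y ∈ u, y = ∑ y ∈ v, y → u ⊆ v := by
    intro u v hu hv hanti h y hy
    obtain ⟨z, hz, hyz⟩ := hprime y ((hS y).1 (hu y hy)) v (by
      rw [← h]; exact JoinLE.le_sum hμ (fun y => y) hy)
    obtain ⟨w, hw, hzw⟩ := hprime z ((hS z).1 (hv z hz)) u (by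
      rw [h]; exact JoinLE.le_sum hμ (fun y => y) hz)
    have := hanti y hy w hw (hyz.trans hzw)
    subst this
    rw [hyz.antisymm hzw]
    exact hz
  rintro v ⟨hv, hvanti, hvsum⟩
  have ht : ∀ y ∈ t, IsPrimitive y := fun y hy => (hS y).2 (hs y (hts hy))
  have e : ∑ y ∈ v, y = ∑ y ∈ t, y := by rw [hvsum, hsum', hsum]
  exact Finset.Subset.antisymm (aux v t hv ht hvanti e) (aux t v ht hv hanti e.symm)

/-- Decompose all terms of the join into a set `t` of primitives. Adding `p` to `t` does not change
its join, so irredundant subsets of `t` and of `insert p t` coincide by uniqueness. The second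
contains an element above `p`, which therefore comes from the decomposition of some term. -/
theorem HasUniqueIrredundantDecompositions.isJoinPrime (hμ : ∀ x : μ, x + x = x)
    (h : HasUniqueIrredundantDecompositions μ) {p : μ} (hp : IsPrimitive p) : IsJoinPrime p := by
  classical
  intro s hs
  choose d hd using fun x => (h x).exists
  let t := s.biUnion d
  have ht : ∀ y ∈ t, IsPrimitive y := by
    intro y hy
    obtain ⟨x, _, hx⟩ := Finset.mem_biUnion.1 hy
    exact (hd x).1 y hx
  have hpt : JoinLE p (∑ y ∈ t, y) := by
    refine hs.trans (JoinLE.sum fun x hx => ?_)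
    rw [← (hd x).2.2]
    exact JoinLE.sum fun y hy =>
      JoinLE.le_sum hμ (fun y => y) (Finset.mem_biUnion.2 ⟨x, hx, hy⟩)
  obtain ⟨a, hat, ha, hasum, -⟩ := exists_irredundant_subset hμ t
  obtain ⟨b, hbt, hb, hbsum, hbelow⟩ := exists_irredundant_subset hμ (insert p t)
  have e : ∑ y ∈ insert p t, y = ∑ y ∈ t, y := by
    refine JoinLE.antisymm (JoinLE.sum fun y hy => ?_) (JoinLE.sum fun y hy =>
      JoinLE.le_sum hμ (fun y => y) (Finset.mem_insert_of_mem hy))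
    rcases Finset.mem_insert.1 hy with rfl | hy
    · exact hpt
    · exact JoinLE.le_sum hμ (fun y => y) hy
  have hab : a = b := by
    refine (h (∑ y ∈ t, y)).unique ⟨fun y hy => ht y (hat hy), ha, hasum⟩
      ⟨fun y hy => ?_, hb, hbsum.trans e⟩
    rcases Finset.mem_insert.1 (hbt hy) with rfl | hy
    · exact hp
    · exact ht y hy
  obtain ⟨z, hz, hpz⟩ := hbelow p (Finset.mem_insert_self _ _)
  obtain ⟨x, hx, hzx⟩ := Finset.mem_biUnion.1 (hat (hab ▸ hz))
  refine ⟨x, hx, hpz.trans ?_⟩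
  have := JoinLE.le_sum hμ (fun y => y) hzx
  rwa [(hd x).2.2] at this

end Semilattice

/-! ### Presentations by a matrix of fractional ideals -/

/-- The order of the free module `M` with finite basis `b` is presented by the matrix `E`. -/
structure POMod.IsPresentedBy {A : Type u} [CommMonoidWithZero A] {P : F1Pair A} (M : POMod P)
    {I : Type u} (b : I → M) (E : I → I → FracIdeal P) : Prop where
  basis : M.IsBasis b
  finite : Finite I
  le_iff : ∀ (i j : I) (a a' : A), a • b i ≤ a' • b j ↔ ∃ e ∈ (E i j).carrier, a = a' * e

/-- Otherwise `R` would be a strict order on the finite set of points above `x`, and a maximal point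
would contradict `hstep`. -/
theorem exists_reflexive_above {Z : Type*} [Finite Z] (R : Z → Z → Prop)
    (htrans : ∀ x y z, R x y → R y z → R x z) (hstep : ∀ x, ∃ y, R x y) (x : Z) :
    ∃ y, R x y ∧ R y y := by
  by_contra! hcon
  let r : {y // R x y} → {y // R x y} → Prop := fun y z => R z.1 y.1
  have : IsTrans _ r := ⟨fun a b c hab hbc => htrans _ _ _ hbc hab⟩
  have : Std.Irrefl r := ⟨fun a => hcon a.1 a.2⟩
  have hwf := Finite.wellFounded_of_trans_of_irrefl r
  obtain ⟨y, hy⟩ := hstep x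
  obtain ⟨m, -, hm⟩ := hwf.has_min Set.univ ⟨⟨y, hy⟩, trivial⟩
  obtain ⟨z, hz⟩ := hstep m.1
  exact hm ⟨z, htrans _ _ _ m.2 hz⟩ trivial hz

section Module

variable {A : Type u} [CommMonoidWithZero A] {P : F1Pair A}
variable {μ : Type u} [AddCommMonoid μ] [Module (FracIdeal P) μ]

open FracIdeal

theorem JoinLE.smul (D : FracIdeal P) {x y : μ} (h : JoinLE x y) : JoinLE (D • x) (D • y) := by
  unfold JoinLE at *
  rw [← smul_add, h]

theorem JoinLE.log_smul {D : FracIdeal P} {a : A} (ha : a ∈ D.carrier) (x : μ) :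
    JoinLE (log P a • x) (D • x) := by
  unfold JoinLE
  rw [← add_smul, log_add_of_mem ha]

theorem JoinLE.smul_of_forall_log {D : FracIdeal P} {x y : μ}
    (h : ∀ a ∈ D.carrier, JoinLE (log P a • x) y) : JoinLE (D • x) y := by
  obtain ⟨F, hF⟩ := D.exists_eq_sum_log
  have : ∀ f ∈ F, f ∈ D.carrier := fun f hf => by
    rw [hF, mem_sum]
    exact Or.inr ⟨f, hf, self_mem_log f⟩
  rw [hF, Finset.sum_smul]
  exact JoinLE.sum fun f hf => h f (this f hf)

set_option maxHeartbeats 800000 in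
-- The matrix is read off from the idempotent `ι (x j) i` of a splitting, restricted to generators
-- with `1` on the diagonal, one for each class up to units.
theorem exists_isPresentedBy_of_projective (hP : P.IsDomain) [Module.Finite (FracIdeal P) μ]
    [Module.Projective (FracIdeal P) μ] :
    HasUniqueIrredundantDecompositions μ ∧ ∃ (h : PrimIsSubmodule μ P) (I : Type u)
      (b : I → primPOMod h) (E : I → I → FracIdeal P), (primPOMod h).IsPresentedBy b E := by
  classical
  have hμ : ∀ x : μ, x + x = x := add_self_of_fracIdeal_module P
  obtain ⟨n, π, hπ⟩ := Module.Finite.exists_fin' (FracIdeal P) μ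
  obtain ⟨ι, hι⟩ := Module.projective_lifting_property π LinearMap.id hπ
  obtain ⟨x, hx⟩ : ∃ x : Fin n → μ, ∀ X, X = ∑ i, ι X i • x i := by
    refine ⟨fun i => π (Pi.single i 1), fun X => ?_⟩
    have h1 : π (ι X) = X := LinearMap.congr_fun hι X
    conv_lhs => rw [← h1, LinearMap.pi_apply_eq_sum_univ π]
    refine Finset.sum_congr rfl fun i _ => ?_
    congr 2
    ext1 j
    simp [Pi.single_apply, eq_comm]
  have hadd : ∀ (X Y : μ) (i : Fin n) (a : A),
      a ∈ (ι (X + Y) i).carrier ↔ a ∈ (ι X i).carrier ∨ a ∈ (ι Y i).carrier := by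
    intro X Y i a
    rw [map_add, Pi.add_apply, mem_add]
  have hmono : ∀ {X Y : μ}, JoinLE X Y → ∀ (i : Fin n) (a : A),
      a ∈ (ι X i).carrier → a ∈ (ι Y i).carrier := by
    intro X Y h i a ha
    rw [← show X + Y = Y from h, hadd]
    exact Or.inl ha
  have hlog : ∀ (a : A) (X : μ) (i : Fin n) (c : A),
      c ∈ (ι (log P a • X) i).carrier ↔ ∃ e ∈ (ι X i).carrier, c = a * e := by
    intro a X i c
    rw [map_smul, Pi.smul_apply, smul_eq_mul, mem_mul]
    constructor
    · rintro ⟨_, ⟨d, hd, rfl⟩, e, he, rfl⟩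
      exact ⟨d * e, mul_mem _ d hd e he, by ac_rfl⟩
    · rintro ⟨e, he, rfl⟩
      exact ⟨a, self_mem_log a, e, he, rfl⟩
  have hle : ∀ {X : μ} {i : Fin n} {a : A}, a ∈ (ι X i).carrier → JoinLE (log P a • x i) X := by
    intro X i a ha
    have h := (JoinLE.log_smul ha (x i)).trans
      (JoinLE.le_sum hμ (fun i => ι X i • x i) (Finset.mem_univ i))
    rwa [← hx X] at h
  -- For `i` in `J`, `hle` and `hle'` together identify `ι X i` with the set of `a` such that `a x_i
  -- ≤ X`; for other `i` only one inclusion is available.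
  let J : Fin n → Prop := fun i => 1 ∈ (ι (x i) i).carrier
  have hle' : ∀ {X : μ} {i : Fin n} {a : A}, J i → JoinLE (log P a • x i) X →
      a ∈ (ι X i).carrier := fun {X i a} hi h =>
    hmono h i a ((hlog _ _ _ _).2 ⟨1, hi, (mul_one a).symm⟩)
  have hmul : ∀ {X : μ} {i j : Fin n} {c e : A}, c ∈ (ι X j).carrier →
      e ∈ (ι (x j) i).carrier → c * e ∈ (ι X i).carrier := fun {X i j c e} hc he =>
    hmono (hle hc) i _ ((hlog _ _ _ _).2 ⟨e, he, rfl⟩)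
  have hsum : ∀ (s : Finset μ) (i : Fin n) {a : A}, a ≠ 0 →
      a ∈ (ι (∑ y ∈ s, y) i).carrier → ∃ y ∈ s, a ∈ (ι y i).carrier := by
    intro s i a ha h
    rw [map_sum, Finset.sum_apply, mem_sum] at h
    exact h.resolve_left ha
  -- the reflexive generators are cofinal
  have hcof : ∀ X : μ, ∃ Z : Finset (Fin n × A), (∀ q ∈ Z, J q.1 ∧ q.2 ≠ 0 ∧
      q.2 ∈ (ι X q.1).carrier) ∧ ∀ (i : Fin n) (a : A), a ≠ 0 → a ∈ (ι X i).carrier →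
      ∃ q ∈ Z, ∃ e ∈ (ι (x q.1) i).carrier, a = q.2 * e := by
    intro X
    choose F hF hgen using fun i => (ι X i).fg
    let Z : Finset (Fin n × A) :=
      Finset.univ.biUnion fun i => ((F i).filter (· ≠ 0)).image fun a => (i, a)
    have hZ : ∀ q, q ∈ Z ↔ q.2 ∈ F q.1 ∧ q.2 ≠ 0 := by
      rintro ⟨i, a⟩
      simp only [Z, Finset.mem_biUnion, Finset.mem_univ, true_and, Finset.mem_image,
        Finset.mem_filter, Prod.mk.injEq]
      constructor
      · rintro ⟨_, _, h, rfl, rfl⟩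
        exact h
      · exact fun h => ⟨i, a, h, rfl, rfl⟩
    -- `R p q` witnesses `p.2 x_{p.1} ≤ q.2 x_{q.1}` through the matrix. After cancellation, `R p p`
    -- with `p.2 ≠ 0` says that `p.1` is in `J`.
    let R : Fin n × A → Fin n × A → Prop := fun p q =>
      ∃ e ∈ (ι (x q.1) p.1).carrier, p.2 = q.2 * e
    have htrans : ∀ p q r, R p q → R q r → R p r := by
      rintro p q r ⟨e, he, h⟩ ⟨f, hf, h'⟩
      exact ⟨f * e, hmul hf he, by rw [h, h', mul_assoc]⟩
    have hstep : ∀ (i : Fin n) (a : A), a ≠ 0 → a ∈ (ι X i).carrier → ∃ q ∈ Z, R (i, a) q := by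
      intro i a ha0 ha
      -- Idempotence of the matrix: `ι X i` is the union over `j` of the products `ι X j * ι (x j)
      -- i`.
      rw [hx X, map_sum, Finset.sum_apply, mem_sum] at ha
      obtain ⟨j, -, h⟩ := ha.resolve_left ha0
      rw [map_smul, Pi.smul_apply, smul_eq_mul, mem_mul] at h
      obtain ⟨d, hd, e, he, rfl⟩ := h
      rcases hgen j d hd with rfl | ⟨c, hc, f, hf, rfl⟩
      · exact absurd (zero_mul e) ha0
      · refine ⟨(j, f), (hZ _).2 ⟨hf, ?_⟩, c * e, mul_mem _ c hc e he, by
          change c * f * e = f * (c * e); ac_rfl⟩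
        rintro rfl
        exact ha0 (by simp)
    have hmemZ : ∀ q ∈ Z, q.2 ≠ 0 ∧ q.2 ∈ (ι X q.1).carrier := fun q hq =>
      ⟨((hZ q).1 hq).2, hF _ ((hZ q).1 hq).1⟩
    refine ⟨Z.filter fun q => J q.1, fun q hq => ?_, fun i a ha0 ha => ?_⟩
    · rw [Finset.mem_filter] at hq
      exact ⟨hq.2, hmemZ q hq.1⟩
    · obtain ⟨q, hq, hR⟩ := hstep i a ha0 ha
      obtain ⟨⟨r, hr⟩, hqr, hrr⟩ := exists_reflexive_above
        (fun p q : {q // q ∈ Z} => R p.1 q.1) (fun p q r => htrans _ _ _)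
        (fun p => by
          obtain ⟨h0, hm⟩ := hmemZ p.1 p.2
          obtain ⟨q, hq, hR⟩ := hstep p.1.1 p.1.2 h0 hm
          exact ⟨⟨q, hq⟩, hR⟩) ⟨q, hq⟩
      refine ⟨r, Finset.mem_filter.2 ⟨hr, ?_⟩, htrans _ _ _ hR hqr⟩
      obtain ⟨e, he, h⟩ := hrr
      have h1 : (1 : A) = e :=
        hP.mul_left_cancel (hmemZ r hr).1 (by rw [mul_one]; exact h)
      change 1 ∈ _
      rw [h1]
      exact he
  let S : Set μ := {p | ∃ (i : Fin n) (a : A), J i ∧ a ≠ 0 ∧ p = log P a • x i}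
  have hprime : ∀ p ∈ S, IsJoinPrime p := by
    rintro _ ⟨i, a, hi, ha, rfl⟩ s hs
    obtain ⟨y, hy, h⟩ := hsum s i ha (hle' hi hs)
    exact ⟨y, hy, hle h⟩
  have hgen : ∀ X : μ, ∃ s : Finset μ, (∀ y ∈ s, y ∈ S) ∧ ∑ y ∈ s, y = X := by
    intro X
    obtain ⟨Z, hZ, hcofZ⟩ := hcof X
    refine ⟨Z.image fun q => log P q.2 • x q.1, fun y hy => ?_, JoinLE.antisymm ?_ ?_⟩
    · obtain ⟨q, hq, rfl⟩ := Finset.mem_image.1 hy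
      exact ⟨q.1, q.2, (hZ q hq).1, (hZ q hq).2.1, rfl⟩
    · refine JoinLE.sum fun y hy => ?_
      obtain ⟨q, hq, rfl⟩ := Finset.mem_image.1 hy
      exact hle (hZ q hq).2.2
    · rw [hx X]
      refine JoinLE.sum fun i _ => JoinLE.smul_of_forall_log fun a ha => ?_
      by_cases ha0 : a = 0
      · rw [ha0, log_zero, zero_smul]
        exact JoinLE.zero _
      obtain ⟨q, hq, e, he, rfl⟩ := hcofZ i a ha0 ha
      rw [log_mul, mul_smul]
      refine ((hle he).smul _).trans ?_
      exact JoinLE.le_sum hμ (fun y => y) (Finset.mem_image_of_mem (fun q => log P q.2 • x q.1) hq)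
  obtain ⟨hS, huniq⟩ := uniqueDecompositions_of_primes hμ S hprime hgen
  have hsub : PrimIsSubmodule μ P := by
    intro a p hp
    obtain ⟨i, c, hi, hc, rfl⟩ := (hS p).1 hp
    by_cases ha : a = 0
    · left; rw [ha, log_zero, zero_smul]
    · right
      rw [hS, ← mul_smul, ← log_mul]
      exact ⟨i, a * c, hi, hP.mul_ne_zero ha hc, rfl⟩
  have hleiff : ∀ {i j : Fin n} {a a' : A}, J i → (JoinLE (log P a • x i) (log P a' • x j) ↔
      ∃ e ∈ (ι (x j) i).carrier, a = a' * e) := fun {i j a a'} hi => by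
    rw [← hlog]
    exact ⟨hle' hi, hle⟩
  -- Equivalence means `x j = e x i` with `e` a unit of `A`: such generators span the same cyclic
  -- factor, so only one of them may enter the basis.
  let st : Setoid {i // J i} :=
    { r := fun i j => ∃ e ∈ (ι (x j.1) i.1).carrier, ∃ e' ∈ (ι (x i.1) j.1).carrier, e * e' = 1
      iseqv := ⟨fun i => ⟨1, i.2, 1, i.2, mul_one 1⟩,
        fun ⟨e, he, e', he', h⟩ => ⟨e', he', e, he, by rw [mul_comm, h]⟩,
        fun ⟨e, he, e', he', h⟩ ⟨f, hf, f', hf', h'⟩ =>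
          ⟨f * e, hmul hf he, e' * f', hmul he' hf', by
            calc f * e * (e' * f') = (e * e') * (f * f') := by ac_rfl
              _ = 1 := by rw [h, h', mul_one]⟩⟩ }
  -- The quotient lives in `Type`, whereas bases are indexed in `Type u`.
  let I : Type u := ULift.{u} (Quotient st)
  let k : I → Fin n := fun q => (Quotient.out q.down).1
  have hk : ∀ q, J (k q) := fun q => (Quotient.out q.down).2
  let b : I → primPOMod hsub := fun q => ⟨x (k q), Or.inr ((hS _).2
    ⟨k q, 1, hk q, hP.nontrivial.symm, by rw [log_one, one_smul]⟩)⟩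
  refine ⟨huniq, hsub, I, b, fun q r => ι (x (k r)) (k q), ⟨?_, ?_, ?_⟩, inferInstance,
    fun q r a a' => hleiff (hk q)⟩
  · intro q a ha h
    have h0 : log P a • x (k q) = 0 := congrArg Subtype.val h
    have h1 : a ∈ (ι (0 : μ) (k q)).carrier := by
      refine hle' (hk q) ?_
      rw [h0]
      exact JoinLE.zero 0
    rw [map_zero, Pi.zero_apply, mem_zero] at h1
    exact ha h1
  · intro q r a a' ha h
    have h0 : log P a • x (k q) = log P a' • x (k r) := congrArg Subtype.val h
    obtain ⟨e, he, hae⟩ := (hleiff (j := k r) (a' := a') (hk q)).1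
      (by rw [h0]; exact hμ _)
    obtain ⟨e', he', hae'⟩ := (hleiff (j := k q) (a' := a) (hk r)).1
      (by rw [h0]; exact hμ _)
    have hee : e * e' = 1 := by
      refine hP.mul_left_cancel (a := a) ha ?_
      calc a * (e * e') = a * e' * e := by ac_rfl
        _ = a * 1 := by rw [← hae', ← hae, mul_one]
    have hqr : q = r := by
      have h1 : Quotient.out q.down ≈ Quotient.out r.down := ⟨e, he, e', he', hee⟩
      exact ULift.down_injective (Quotient.out_equiv_out.1 h1)
    subst hqr
    -- The diagonal ideal contains `1` and is closed under products, so it lies in `A⁺`; sharpness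
    -- then forces the unit `e` to be `1`.
    have hplus : ∀ c ∈ (ι (x (k q)) (k q)).carrier, c ∈ P.plus := fun c hc =>
      hP.mem_plus_of_pow_mem (hk q) (fun _ h _ h' => hmul h h') hc
    have he1 := hP.sharp e (hplus e he) e' (hplus e' he') hee
    exact ⟨rfl, by rw [hae, he1, mul_one]⟩
  · rintro ⟨p, hp⟩ hp0
    rcases hp with rfl | hp
    · exact absurd rfl hp0
    obtain ⟨i, a, hi, ha, rfl⟩ := (hS p).1 hp
    let q : I := ⟨Quotient.mk st ⟨i, hi⟩⟩
    obtain ⟨e, he, e', he', h⟩ :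
        ∃ e ∈ (ι (x i) (k q)).carrier, ∃ e' ∈ (ι (x (k q)) i).carrier, e * e' = 1 :=
      Quotient.mk_out (s := st) ⟨i, hi⟩
    refine ⟨q, a * e, Subtype.ext (JoinLE.antisymm ?_ ?_)⟩
    · exact (hleiff hi).2 ⟨e', he', by rw [mul_assoc, h, mul_one]⟩
    · exact (hleiff (hk q)).2 ⟨e, he, rfl⟩

end Module

/-! ### From a matrix presentation to projectivity -/

section Module

variable {A : Type u} [CommMonoidWithZero A] {P : F1Pair A}
variable {μ : Type u} [AddCommMonoid μ] [Module (FracIdeal P) μ]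

open FracIdeal

theorem IsPrimitive.ne_zero {x : μ} (hx : IsPrimitive x) : x ≠ 0 := by
  rintro rfl
  exact absurd (hx ∅ Finset.sum_empty) (Finset.notMem_empty _)

theorem IsJoinPrime.le_add (hμ : ∀ x : μ, x + x = x) {p x y : μ} (hp : IsJoinPrime p)
    (h : JoinLE p (x + y)) : JoinLE p x ∨ JoinLE p y := by
  classical
  obtain ⟨z, hz, hpz⟩ := hp {x, y} (h.trans
    ((JoinLE.le_sum hμ (fun y => y) (Finset.mem_insert_self _ _)).add
      (JoinLE.le_sum hμ (fun y => y) (Finset.mem_insert_of_mem (Finset.mem_singleton_self _)))))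
  rcases Finset.mem_insert.1 hz with rfl | hz
  · exact Or.inl hpz
  · rw [Finset.mem_singleton.1 hz] at hpz
    exact Or.inr hpz

/-- The coordinates `D i X = {a | a x_i ≤ X}` form a linear section of the map that sends the
standard basis to the `x i`. -/
theorem POMod.IsPresentedBy.finite_projective (huniq : HasUniqueIrredundantDecompositions μ)
    {h : PrimIsSubmodule μ P} {I : Type u} {b : I → primPOMod h} {E : I → I → FracIdeal P}
    (hE : (primPOMod h).IsPresentedBy b E) :
    Module.Finite (FracIdeal P) μ ∧ Module.Projective (FracIdeal P) μ := by
  classical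
  have hμ : ∀ x : μ, x + x = x := add_self_of_fracIdeal_module P
  have := hE.finite
  let _ := Fintype.ofFinite I
  let x : I → μ := fun i => (b i).1
  have hlezero : ∀ {a : A} (i : I) (X : μ), a = 0 → JoinLE (log P a • x i) X := by
    rintro a i X rfl
    rw [log_zero, zero_smul]
    exact JoinLE.zero X
  have hprim : ∀ (i : I) (a : A), a ≠ 0 → IsJoinPrime (log P a • x i) := by
    intro i a ha
    refine huniq.isJoinPrime hμ ((a • b i).2.resolve_left fun h0 => ?_)
    exact hE.basis.smul_ne_zero i a ha (Subtype.ext h0)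
  have hle : ∀ (i j : I) (a c : A), a ∈ (log P c * E i j).carrier ↔
      JoinLE (log P a • x i) (log P c • x j) := by
    intro i j a c
    refine Iff.trans ?_ (hE.le_iff i j a c).symm
    rw [mem_mul]
    constructor
    · rintro ⟨_, ⟨d, hd, rfl⟩, e, he, rfl⟩
      exact ⟨d * e, mul_mem _ d hd e he, by ac_rfl⟩
    · rintro ⟨e, he, rfl⟩
      exact ⟨c, self_mem_log c, e, he, rfl⟩
  have hgen : ∀ X : μ, X ∈ AddSubmonoid.closure
      (Set.range fun q : I × A => log P q.2 • x q.1) := by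
    intro X
    obtain ⟨s, hs, -, rfl⟩ := (huniq X).exists
    refine sum_mem fun y hy => AddSubmonoid.subset_closure ?_
    obtain ⟨j, c, hjc⟩ := hE.basis.generates ⟨y, Or.inr (hs y hy)⟩ fun h0 =>
      (hs y hy).ne_zero (congrArg Subtype.val h0)
    exact ⟨(j, c), (congrArg Subtype.val hjc).symm⟩
  -- Finite generation is proved along a decomposition of `X`: on `c x_j` the set is `A⁺c * E i j`,
  -- and primality turns joins into unions.
  have hD : ∀ (i : I) (X : μ), ∃ D : FracIdeal P, ∀ a, a ∈ D.carrier ↔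
      JoinLE (log P a • x i) X := by
    intro i X
    induction hgen X using AddSubmonoid.closure_induction with
    | mem X hX =>
      obtain ⟨q, rfl⟩ := hX
      exact ⟨log P q.2 * E i q.1, fun a => hle i q.1 a q.2⟩
    | zero =>
      refine ⟨0, fun a => mem_zero.trans ⟨hlezero i 0, fun h => ?_⟩⟩
      by_contra ha
      obtain ⟨y, hy, -⟩ := hprim i a ha ∅ (by rwa [Finset.sum_empty])
      exact absurd hy (Finset.notMem_empty y)
    | add X Y _ _ hX hY =>
      obtain ⟨D, hD⟩ := hX
      obtain ⟨D', hD'⟩ := hY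
      refine ⟨D + D', fun a => ?_⟩
      rw [mem_add, hD, hD']
      refine ⟨?_, fun h => ?_⟩
      · rintro (h | h)
        · exact h.trans (JoinLE.left hμ X Y)
        · exact h.trans (JoinLE.right hμ X Y)
      · by_cases ha : a = 0
        · exact Or.inl (hlezero i X ha)
        · exact (hprim i a ha).le_add hμ h
  choose D hD using hD
  have hDgen : ∀ (i j : I) (c : A), D i (log P c • x j) = log P c * E i j := fun i j c =>
    FracIdeal.ext fun a => by rw [hD, hle]
  have hDzero : ∀ i, D i 0 = 0 := fun i => FracIdeal.ext fun a => by
    rw [hD, mem_zero]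
    refine ⟨fun h => ?_, hlezero i 0⟩
    by_contra ha
    obtain ⟨y, hy, -⟩ := hprim i a ha ∅ (by rwa [Finset.sum_empty])
    exact absurd hy (Finset.notMem_empty y)
  have hDadd : ∀ i X Y, D i (X + Y) = D i X + D i Y := fun i X Y => FracIdeal.ext fun a => by
    rw [mem_add, hD, hD, hD]
    refine ⟨fun h => ?_, ?_⟩
    · by_cases ha : a = 0
      · exact Or.inl (hlezero i X ha)
      · exact (hprim i a ha).le_add hμ h
    · rintro (h | h)
      · exact h.trans (JoinLE.left hμ X Y)
      · exact h.trans (JoinLE.right hμ X Y)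
  let Dh : I → μ →+ FracIdeal P := fun i => ⟨⟨D i, hDzero i⟩, hDadd i⟩
  have hDsmul : ∀ i (B : FracIdeal P) X, D i (B • X) = B * D i X := by
    intro i B X
    induction hgen X using AddSubmonoid.closure_induction with
    | mem X hX =>
      obtain ⟨⟨j, c⟩, rfl⟩ := hX
      obtain ⟨F, rfl⟩ := B.exists_eq_sum_log
      change Dh i _ = _
      rw [Finset.sum_smul, map_sum, Finset.sum_mul]
      refine Finset.sum_congr rfl fun f _ => ?_
      change D i _ = _
      rw [← mul_smul, ← log_mul, hDgen, hDgen, log_mul, mul_assoc]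
    | zero => rw [smul_zero, hDzero, mul_zero]
    | add X Y _ _ hX hY => rw [smul_add, hDadd, hDadd, hX, hY, mul_add]
  let ι : μ →ₗ[FracIdeal P] I → FracIdeal P := LinearMap.pi fun i =>
    { toFun := D i, map_add' := hDadd i, map_smul' := hDsmul i }
  let π : (I → FracIdeal P) →ₗ[FracIdeal P] μ := Fintype.linearCombination (FracIdeal P) x
  have hπι : ∀ X, π (ι X) = X := by
    intro X
    have e : π (ι X) = ∑ i, D i X • x i := rfl
    rw [e]
    refine JoinLE.antisymm
      (JoinLE.sum fun i _ => JoinLE.smul_of_forall_log fun a ha => (hD i X a).1 ha) ?_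
    have key : ∀ i a, JoinLE (log P a • x i) X → JoinLE (log P a • x i) (∑ i, D i X • x i) :=
      fun i a h => (JoinLE.log_smul ((hD i X a).2 h) (x i)).trans
        (JoinLE.le_sum hμ (fun i => D i X • x i) (Finset.mem_univ i))
    -- Passing to all `Y ≤ X` lets the induction run over `Y` while the target sum stays fixed.
    suffices ∀ Y, JoinLE Y X → JoinLE Y (∑ i, D i X • x i) from this X (hμ X)
    intro Y
    induction hgen Y using AddSubmonoid.closure_induction with
    | mem Y hY =>
      obtain ⟨q, rfl⟩ := hY
      exact key q.1 q.2
    | zero => exact fun _ => JoinLE.zero _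
    | add Y Z _ _ hY hZ =>
      exact fun h => (hY ((JoinLE.left hμ Y Z).trans h)).add (hZ ((JoinLE.right hμ Y Z).trans h))
  exact ⟨Module.Finite.of_surjective π fun X => ⟨ι X, hπι X⟩,
    Module.Projective.of_split ι π (LinearMap.ext hπι)⟩

end Module

/-! ### Torsion-freeness, and properties of orders presented by a matrix -/

namespace POMod

variable {A : Type u} [CommMonoidWithZero A] {P : F1Pair A} {M : POMod P}

theorem zero_le (x : M) : 0 ≤ x := by
  have := M.smul_le_smul_left 0 1 x ⟨0, P.zero_mem, by simp⟩
  rwa [zero_smul, one_smul] at this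

theorem le_zero_iff {x : M} : x ≤ 0 ↔ x = 0 :=
  ⟨fun h => le_antisymm h (zero_le x), fun h => h.le⟩

theorem smul_le_of_mem {c : A} (hc : c ∈ P.plus) (x : M) : c • x ≤ x := by
  have := M.smul_le_smul_left c 1 x ⟨c, hc, by simp⟩
  rwa [one_smul] at this

section Basis

variable {I : Type u} {b : I → M}

theorem IsBasis.eq_zero_or (hb : M.IsBasis b) (x : M) : x = 0 ∨ ∃ (i : I) (a : A), x = a • b i :=
  or_iff_not_imp_left.2 (hb.generates x)

theorem IsBasis.smul_eq_zero (hb : M.IsBasis b) {a : A} {i : I} (h : a • b i = 0) : a = 0 := by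
  by_contra ha
  exact hb.smul_ne_zero i a ha h

theorem IsBasis.smul_left_injective (hb : M.IsBasis b) (i : I) {a a' : A}
    (h : a • b i = a' • b i) : a = a' := by
  by_cases ha : a = 0
  · rw [ha, zero_smul] at h
    rw [ha, hb.smul_eq_zero h.symm]
  · exact (hb.injective i i a a' ha h).2

theorem IsBasis.ne_zero (hP : P.IsDomain) (hb : M.IsBasis b) (i : I) : b i ≠ 0 := by
  have := hb.smul_ne_zero i 1 hP.nontrivial.symm
  rwa [one_smul] at this

theorem IsBasis.smul_cancel (hP : P.IsDomain) (hb : M.IsBasis b) {s : A} (hs : s ≠ 0) {x y : M}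
    (h : s • x = s • y) : x = y := by
  have aux : ∀ z : M, s • z = 0 → z = 0 := by
    intro z hz
    rcases hb.eq_zero_or z with rfl | ⟨i, a, rfl⟩
    · rfl
    · rw [← mul_smul] at hz
      have h0 := hb.smul_eq_zero hz
      by_cases ha : a = 0
      · rw [ha, zero_smul]
      · exact absurd h0 (hP.mul_ne_zero hs ha)
  rcases hb.eq_zero_or x with rfl | ⟨i, a, rfl⟩
  · rw [smul_zero] at h
    exact (aux y h.symm).symm
  by_cases ha : a = 0
  · rw [ha, zero_smul, smul_zero] at h
    rw [ha, zero_smul, aux y h.symm]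
  rcases hb.eq_zero_or y with rfl | ⟨j, a', rfl⟩
  · rw [smul_zero] at h
    exact aux _ h
  · rw [← mul_smul, ← mul_smul] at h
    obtain ⟨rfl, h'⟩ := hb.injective i j _ _ (hP.mul_ne_zero hs ha) h
    rw [hP.mul_left_cancel hs h']

/-- If the edges of a quiver are sent to order relations of `M`, then so are its paths. -/
theorem pathWeight_smul_le [Quiver.{u + 1} I] {w : ∀ {i j : I}, (i ⟶ j) → A}
    (hw : ∀ {i j : I} (e : i ⟶ j), w e • b j ≤ b i) {i j : I} (γ : Quiver.Path i j) :
    pathWeight w γ • b j ≤ b i := by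
  induction γ with
  | nil => rw [pathWeight, one_smul]
  | cons p e ih =>
    rw [pathWeight, mul_comm, mul_smul]
    exact (M.smul_le_smul_right _ _ _ (hw e)).trans ih

theorem QuiverLE.le [Quiver.{u + 1} I] {w : ∀ {i j : I}, (i ⟶ j) → A}
    (hw : ∀ {i j : I} (e : i ⟶ j), w e • b j ≤ b i) {x y : M} (h : QuiverLE b w x y) :
    x ≤ y := by
  rcases h with rfl | ⟨i, j, γ, c, a, hc, rfl, rfl⟩
  · exact zero_le y
  · rw [mul_comm, mul_smul, mul_smul]
    exact M.smul_le_smul_right _ _ _ ((smul_le_of_mem hc _).trans (pathWeight_smul_le hw γ))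

/-- Comparison of fractions with elements of a torsion-free module. -/
theorem IsBasis.toFrac_eq_iff (hP : P.IsDomain) (hb : M.IsBasis b) {m n : M}
    {s : nonZeroDivisors A} : M.toFrac m = OreLocalization.oreDiv n s ↔ (s : A) • m = n := by
  unfold toFrac
  rw [OreLocalization.oreDiv_eq_iff]
  constructor
  · rintro ⟨u, v, h, h'⟩
    refine (hb.smul_cancel hP (hP.ne_zero_of_mem_nonZeroDivisors u.2) ?_).symm
    rw [← mul_smul]
    have h2 : (u : A) * s = v := by simpa using h'
    rw [h2]
    exact h
  · rintro rfl
    refine ⟨1, s, ?_, ?_⟩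
    · rw [one_smul]
    · simp

namespace IsPresentedBy

variable {E : I → I → FracIdeal P}

theorem mem_iff (hE : M.IsPresentedBy b E) {i j : I} {a : A} :
    a ∈ (E i j).carrier ↔ a • b i ≤ b j := by
  have := hE.le_iff i j a 1
  rw [one_smul] at this
  rw [this]
  simp

/-- Transitivity of the order makes the diagonal ideal multiplicatively closed, so integral
closedness applies. -/
theorem mem_diag_iff (hP : P.IsDomain) (hE : M.IsPresentedBy b E) {i : I} {a : A} :
    a ∈ (E i i).carrier ↔ a ∈ P.plus := by
  refine ⟨hP.mem_plus_of_pow_mem ?_ fun c hc d hd => ?_, fun h => ?_⟩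
  · rw [hE.mem_iff, one_smul]
  · rw [hE.mem_iff] at hc hd ⊢
    rw [mul_smul]
    exact (M.smul_le_smul_right _ _ _ hd).trans hc
  · rw [hE.mem_iff]
    exact smul_le_of_mem h _

theorem isNondegenerate (hP : P.IsDomain) (hE : M.IsPresentedBy b E) : M.IsNondegenerate := by
  rintro J b' hb' i x y ⟨a, rfl⟩ ⟨a', rfl⟩
  constructor
  · intro h
    -- Non-degeneracy concerns every basis `b'`; writing `b' i` as a multiple of some `b j` reduces
    -- it to the diagonal ideal `E j j`.
    obtain ⟨j, g, hg⟩ := hE.basis.generates _ (hb'.ne_zero hP i)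
    rw [hg, ← mul_smul, ← mul_smul] at h ⊢
    obtain ⟨e, he, h'⟩ := (hE.le_iff _ _ _ _).1 h
    exact ⟨e, (hE.mem_diag_iff hP).1 he, by rw [← mul_smul, h', mul_comm]⟩
  · rintro ⟨c, hc, h⟩
    rw [h]
    exact smul_le_of_mem hc _

theorem isPresentedByFiniteQuiver (hE : M.IsPresentedBy b E) : M.IsPresentedByFiniteQuiver := by
  choose F hF hgen using fun i j => (E i j).fg
  -- The indices are swapped: an edge `i ⟶ j` of weight `f` records `f • b j ≤ b i`, that is, `f ∈ E
  -- j i`.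
  let q : Quiver.{u + 1} I := ⟨fun i j => ULift.{u + 1} {a : A // a ∈ F j i}⟩
  let w : ∀ {i j : I}, (i ⟶ j) → A := fun e => (ULift.down e).1
  have hw : ∀ {i j : I} (e : i ⟶ j), w e • b j ≤ b i := fun {i j} e =>
    hE.mem_iff.1 (hF j i (ULift.down e).2)
  refine ⟨I, b, q, w, hE.basis, hE.finite,
    fun i j => inferInstanceAs (Finite (ULift.{u + 1} {a : A // a ∈ F j i})), fun x y => ⟨fun h => ?_, QuiverLE.le hw⟩⟩
  rcases hE.basis.eq_zero_or x with hx | ⟨i, a, rfl⟩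
  · exact Or.inl hx
  rcases hE.basis.eq_zero_or y with rfl | ⟨j, a', rfl⟩
  · exact Or.inl (le_zero_iff.1 h)
  obtain ⟨e, he, rfl⟩ := (hE.le_iff _ _ _ _).1 h
  rcases hgen i j e he with rfl | ⟨c, hc, f, hf, rfl⟩
  · left
    rw [mul_zero, zero_smul]
  · refine Or.inr ⟨j, i, Quiver.Hom.toPath (show j ⟶ i from ⟨⟨f, hf⟩⟩), c, a', hc, rfl, ?_⟩
    have : pathWeight w (Quiver.Hom.toPath (show j ⟶ i from ⟨⟨f, hf⟩⟩)) = f := by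
      rw [Quiver.Hom.toPath, pathWeight, pathWeight, mul_one]
    rw [this, mul_comm]

theorem le_of_smul_le (hP : P.IsDomain) (hE : M.IsPresentedBy b E) {s : A} (hs : s ≠ 0) {x y : M}
    (h : s • x ≤ s • y) : x ≤ y := by
  rcases hE.basis.eq_zero_or x with rfl | ⟨i, a, rfl⟩
  · exact zero_le y
  rcases hE.basis.eq_zero_or y with rfl | ⟨j, a', rfl⟩
  · rw [smul_zero, le_zero_iff] at h
    rw [hE.basis.smul_cancel hP hs (h.trans (smul_zero s).symm)]
  rw [← mul_smul, ← mul_smul, hE.le_iff] at h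
  obtain ⟨e, he, h⟩ := h
  exact (hE.le_iff _ _ _ _).2 ⟨e, he, hP.mul_left_cancel hs (by rw [h, mul_assoc])⟩

/-- Lowerness is divisibility: `a • b i ≤ (s a') • b j` forces `a = s a' e`, so every numerator
below `s • m` is itself divisible by `s`. -/
theorem isLowerInFrac (hP : P.IsDomain) (hE : M.IsPresentedBy b E) : M.IsLowerInFrac := by
  have hb := hE.basis
  refine ⟨fun m m' h => ?_, fun m m' => ⟨?_, fun h => ⟨m, m', 1, h, rfl, rfl⟩⟩, ?_⟩
  · simpa using (hb.toFrac_eq_iff hP (s := 1)).1 h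
  · rintro ⟨n, n', s, hle, h, h'⟩
    rw [hb.toFrac_eq_iff hP] at h h'
    subst h h'
    exact hE.le_of_smul_le hP (hP.ne_zero_of_mem_nonZeroDivisors s.2) hle
  · rintro z m ⟨n, n', s, hle, rfl, h'⟩
    rw [hb.toFrac_eq_iff hP] at h'
    subst h'
    suffices ∃ m', (s : A) • m' = n by
      obtain ⟨m', h⟩ := this
      exact ⟨m', ((hb.toFrac_eq_iff hP).2 h).symm⟩
    rcases hb.eq_zero_or n with rfl | ⟨i, a, rfl⟩
    · exact ⟨0, smul_zero _⟩
    rcases hb.eq_zero_or m with rfl | ⟨j, a', rfl⟩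
    · rw [smul_zero, le_zero_iff] at hle
      exact ⟨0, by rw [smul_zero, hle]⟩
    rw [← mul_smul, hE.le_iff] at hle
    obtain ⟨e, -, rfl⟩ := hle
    exact ⟨(a' * e) • b i, by rw [← mul_smul, mul_assoc]⟩

end IsPresentedBy

end Basis

end POMod

/-! ### Filtered colimits of partially ordered modules -/

namespace POMod

variable {A : Type u} [CommMonoidWithZero A] {P : F1Pair A}

/-- The underlying map of a morphism of partially ordered modules. -/
def app {M N : POMod P} (f : M ⟶ N) : M → N := Hom.toFun f

theorem hom_ext {M N : POMod P} {f g : M ⟶ N} (h : ∀ x, app f x = app g x) : f = g :=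
  Hom.ext (funext h)

theorem app_zero {M N : POMod P} (f : M ⟶ N) : app f 0 = 0 := Hom.map_zero f

theorem app_smul {M N : POMod P} (f : M ⟶ N) (a : A) (x : M) : app f (a • x) = a • app f x :=
  Hom.map_smul f a x

theorem app_mono {M N : POMod P} (f : M ⟶ N) : Monotone (app f) := Hom.monotone f

theorem app_id (M : POMod P) (x : M) : app (𝟙 M) x = x := rfl

theorem app_comp {M N L : POMod P} (f : M ⟶ N) (g : N ⟶ L) (x : M) :
    app (f ≫ g) x = app g (app f x) := rfl

section Colimit

variable {J : Type u} [SmallCategory J]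

theorem app_cocone {D : J ⥤ POMod P} (c : Limits.Cocone D) {j k : J} (f : j ⟶ k) (x : D.obj j) :
    app (c.ι.app k) (app (D.map f) x) = app (c.ι.app j) x := by
  rw [← app_comp, c.w]

theorem app_map_comp (D : J ⥤ POMod P) {j k l : J} (f : j ⟶ k) (g : k ⟶ l) (x : D.obj j) :
    app (D.map (f ≫ g)) x = app (D.map g) (app (D.map f) x) := by
  rw [D.map_comp, app_comp]

/-- A cocone is a colimit cocone if its maps are jointly surjective and every inequality in its
point already holds at some stage. -/
noncomputable def isColimitOf {D : J ⥤ POMod P} (c : Limits.Cocone D)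
    (hsurj : ∀ z : c.pt, ∃ (j : J) (x : D.obj j), app (c.ι.app j) x = z)
    (hle : ∀ (j k : J) (x : D.obj j) (y : D.obj k), app (c.ι.app j) x ≤ app (c.ι.app k) y →
      ∃ (l : J) (f : j ⟶ l) (g : k ⟶ l), app (D.map f) x ≤ app (D.map g) y) :
    Limits.IsColimit c := by
  choose st pt hpt using hsurj
  have hle' : ∀ (s : Limits.Cocone D) (j k : J) (x : D.obj j) (y : D.obj k),
      app (c.ι.app j) x ≤ app (c.ι.app k) y → app (s.ι.app j) x ≤ app (s.ι.app k) y := by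
    intro s j k x y h
    obtain ⟨l, f, g, h'⟩ := hle j k x y h
    have := app_mono (s.ι.app l) h'
    rwa [app_cocone, app_cocone] at this
  -- Equality is split into two inequalities, which may be witnessed at different stages;
  -- antisymmetry in `s.pt` reunites them.
  have heq : ∀ (s : Limits.Cocone D) (j k : J) (x : D.obj j) (y : D.obj k),
      app (c.ι.app j) x = app (c.ι.app k) y → app (s.ι.app j) x = app (s.ι.app k) y :=
    fun s j k x y h => le_antisymm (hle' s j k x y h.le) (hle' s k j y x h.ge)
  let desc : ∀ s : Limits.Cocone D, c.pt ⟶ s.pt := fun s =>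
    { toFun := fun z => app (s.ι.app (st z)) (pt z)
      map_zero := by
        have := heq s _ (st 0) (pt 0) 0 (by rw [hpt, app_zero])
        rw [this, app_zero]
      map_smul := fun a z => by
        rw [← app_smul]
        exact heq s _ _ _ _ (by rw [hpt, app_smul, hpt])
      monotone := fun z w h => hle' s _ _ _ _ (by rwa [hpt, hpt]) }
  exact
    { desc := desc
      fac := fun s j => hom_ext fun x => heq s _ _ _ _ (hpt _)
      uniq := fun s m hm => hom_ext fun z => by
        change _ = app (s.ι.app (st z)) (pt z)
        rw [← hm, app_comp, hpt] }

variable [IsFiltered J]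

/-- The elements of the objects of a diagram, before identification in the colimit. -/
structure ColimitPt (D : J ⥤ POMod P) : Type u where
  stage : J
  elt : D.obj stage

namespace ColimitPt

variable {D : J ⥤ POMod P}

/-- An inequality between elements holds in the colimit if it holds at some later stage. -/
instance : Preorder (ColimitPt D) where
  le p q := ∃ (l : J) (f : p.stage ⟶ l) (g : q.stage ⟶ l),
    app (D.map f) p.elt ≤ app (D.map g) q.elt
  le_refl p := ⟨p.stage, 𝟙 _, 𝟙 _, le_rfl⟩
  le_trans := by
    rintro p q r ⟨k, f, g, h⟩ ⟨k', f', g', h'⟩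
    obtain ⟨l, a, b, hab⟩ := IsFiltered.span g f'
    refine ⟨l, f ≫ a, g' ≫ b, ?_⟩
    rw [app_map_comp, app_map_comp]
    refine (app_mono _ h).trans ?_
    rw [← app_map_comp, hab, app_map_comp]
    exact app_mono _ h'

theorem le_def {p q : ColimitPt D} : p ≤ q ↔ ∃ (l : J) (f : p.stage ⟶ l) (g : q.stage ⟶ l),
    app (D.map f) p.elt ≤ app (D.map g) q.elt := Iff.rfl

/-- The action of `A` before identification in the colimit. -/
def smul (a : A) (p : ColimitPt D) : ColimitPt D := ⟨p.stage, a • p.elt⟩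

theorem smul_mono (a : A) {p q : ColimitPt D} (h : p ≤ q) : p.smul a ≤ q.smul a := by
  obtain ⟨l, f, g, h⟩ := le_def.1 h
  refine le_def.2 ⟨l, f, g, ?_⟩
  change app (D.map f) (a • p.elt) ≤ app (D.map g) (a • q.elt)
  rw [app_smul, app_smul]
  exact (D.obj l).smul_le_smul_right a _ _ h

theorem mk_zero_le (j : J) (q : ColimitPt D) : (⟨j, 0⟩ : ColimitPt D) ≤ q := by
  refine le_def.2 ⟨IsFiltered.max j q.1, IsFiltered.leftToMax _ _, IsFiltered.rightToMax _ _, ?_⟩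
  change app _ 0 ≤ _
  rw [app_zero]
  exact zero_le _

theorem mk_le_mk {j : J} {x y : D.obj j} (h : x ≤ y) : (⟨j, x⟩ : ColimitPt D) ≤ ⟨j, y⟩ :=
  le_def.2 ⟨j, 𝟙 _, 𝟙 _, app_mono _ h⟩

theorem mk_le_map {j k : J} (f : j ⟶ k) (x : D.obj j) :
    (⟨j, x⟩ : ColimitPt D) ≤ ⟨k, app (D.map f) x⟩ :=
  le_def.2 ⟨k, f, 𝟙 k, by rw [D.map_id, app_id]⟩

theorem map_le_mk {j k : J} (f : j ⟶ k) (x : D.obj j) :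
    (⟨k, app (D.map f) x⟩ : ColimitPt D) ≤ ⟨j, x⟩ :=
  le_def.2 ⟨k, 𝟙 k, f, by rw [D.map_id, app_id]⟩

end ColimitPt

/-- The set of elements of the filtered colimit of a diagram of partially ordered modules. -/
abbrev ColimitSet (D : J ⥤ POMod P) : Type u := Antisymmetrization (ColimitPt D) (· ≤ ·)

/-- The class of an element in the colimit. -/
def toColimitSet {D : J ⥤ POMod P} (p : ColimitPt D) : ColimitSet D := toAntisymmetrization _ p

theorem toColimitSet_eq {D : J ⥤ POMod P} {p q : ColimitPt D} (h : p ≤ q) (h' : q ≤ p) :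
    toColimitSet p = toColimitSet q := Quotient.sound ⟨h, h'⟩

theorem toColimitSet_le {D : J ⥤ POMod P} {p q : ColimitPt D} :
    toColimitSet p ≤ toColimitSet q ↔ p ≤ q := Iff.rfl

theorem ColimitSet.ind {D : J ⥤ POMod P} {C : ColimitSet D → Prop}
    (h : ∀ p, C (toColimitSet p)) (z : ColimitSet D) : C z := Quotient.ind h z

noncomputable instance (D : J ⥤ POMod P) : Zero (ColimitSet D) :=
  ⟨toColimitSet ⟨(IsFiltered.nonempty (C := J)).some, 0⟩⟩

theorem toColimitSet_zero {D : J ⥤ POMod P} (j : J) :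
    toColimitSet (⟨j, 0⟩ : ColimitPt D) = 0 :=
  toColimitSet_eq (ColimitPt.mk_zero_le _ _) (ColimitPt.mk_zero_le _ _)

instance (D : J ⥤ POMod P) : SMul A (ColimitSet D) :=
  ⟨fun a => Quotient.map (ColimitPt.smul a) fun _ _ h =>
    ⟨ColimitPt.smul_mono a h.1, ColimitPt.smul_mono a h.2⟩⟩

theorem smul_toColimitSet {D : J ⥤ POMod P} (a : A) (p : ColimitPt D) :
    a • toColimitSet p = toColimitSet ⟨p.stage, a • p.elt⟩ := rfl

noncomputable instance (D : J ⥤ POMod P) : MulActionWithZero A (ColimitSet D) where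
  one_smul := ColimitSet.ind fun p => by rw [smul_toColimitSet, one_smul]
  mul_smul a b := ColimitSet.ind fun p => by
    rw [smul_toColimitSet, smul_toColimitSet, smul_toColimitSet, mul_smul]
  smul_zero a := by
    change a • toColimitSet _ = _
    rw [smul_toColimitSet, smul_zero, toColimitSet_zero]
  zero_smul := ColimitSet.ind fun p => by
    rw [smul_toColimitSet, zero_smul, toColimitSet_zero]

/-- The filtered colimit of a diagram of partially ordered modules. -/
noncomputable def filteredColimit (D : J ⥤ POMod P) : POMod P where
  carrier := ColimitSet D
  smul_le_smul_left f g := ColimitSet.ind fun p h => by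
    rw [smul_toColimitSet, smul_toColimitSet, toColimitSet_le]
    exact ColimitPt.mk_le_mk ((D.obj _).smul_le_smul_left f g _ h)
  smul_le_smul_right a := ColimitSet.ind fun p => ColimitSet.ind fun q h =>
    ColimitPt.smul_mono a (toColimitSet_le.1 h)

/-- The cocone of `filteredColimit`. -/
noncomputable def filteredCocone (D : J ⥤ POMod P) : Limits.Cocone D where
  pt := filteredColimit D
  ι :=
    { app := fun j =>
        { toFun := fun x => toColimitSet ⟨j, x⟩
          map_zero := toColimitSet_zero j
          map_smul := fun a x => (smul_toColimitSet a ⟨j, x⟩).symm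
          monotone := fun _ _ h => toColimitSet_le.2 (ColimitPt.mk_le_mk h) }
      naturality := fun _ _ f => hom_ext fun x =>
        toColimitSet_eq (ColimitPt.map_le_mk f x) (ColimitPt.mk_le_map f x) }

theorem filteredCocone_surj (D : J ⥤ POMod P) (z : (filteredCocone D).pt) :
    ∃ (j : J) (x : D.obj j), app ((filteredCocone D).ι.app j) x = z :=
  ColimitSet.ind (C := fun z => ∃ (j : J) (x : D.obj j), app ((filteredCocone D).ι.app j) x = z)
    (fun p => ⟨p.stage, p.elt, rfl⟩) z

theorem filteredCocone_le (D : J ⥤ POMod P) (j k : J) (x : D.obj j) (y : D.obj k)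
    (h : app ((filteredCocone D).ι.app j) x ≤ app ((filteredCocone D).ι.app k) y) :
    ∃ (l : J) (f : j ⟶ l) (g : k ⟶ l), app (D.map f) x ≤ app (D.map g) y :=
  ColimitPt.le_def.1 (toColimitSet_le.1 h)

/-- `filteredColimit` is a colimit. -/
noncomputable def filteredCoconeIsColimit (D : J ⥤ POMod P) :
    Limits.IsColimit (filteredCocone D) :=
  isColimitOf _ (filteredCocone_surj D) (filteredCocone_le D)

/-- An arbitrary colimit is compared with the explicit one, where the claim holds by construction.
-/
theorem exists_of_isColimit {D : J ⥤ POMod P} {c : Limits.Cocone D} (hc : Limits.IsColimit c)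
    (z : c.pt) : ∃ (j : J) (x : D.obj j), app (c.ι.app j) x = z := by
  let d := (filteredCoconeIsColimit D).desc c
  let d' := hc.desc (filteredCocone D)
  have hd : ∀ j, (filteredCocone D).ι.app j ≫ d = c.ι.app j := (filteredCoconeIsColimit D).fac c
  have hd' : ∀ j, c.ι.app j ≫ d' = (filteredCocone D).ι.app j := hc.fac _
  have hid : d' ≫ d = 𝟙 c.pt := hc.hom_ext fun j => by
    rw [← Category.assoc, hd', hd, Category.comp_id]
  obtain ⟨j, x, hx⟩ := filteredCocone_surj D (app d' z)
  refine ⟨j, x, ?_⟩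
  rw [← hd, app_comp, hx, ← app_comp, hid, app_id]

theorem exists_le_of_isColimit {D : J ⥤ POMod P} {c : Limits.Cocone D} (hc : Limits.IsColimit c)
    {j k : J} {x : D.obj j} {y : D.obj k} (h : app (c.ι.app j) x ≤ app (c.ι.app k) y) :
    ∃ (l : J) (f : j ⟶ l) (g : k ⟶ l), app (D.map f) x ≤ app (D.map g) y := by
  have hd' : ∀ j, c.ι.app j ≫ hc.desc (filteredCocone D) = (filteredCocone D).ι.app j := hc.fac _
  have h' := app_mono (hc.desc (filteredCocone D)) h
  rw [← app_comp, ← app_comp, hd', hd'] at h'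
  exact filteredCocone_le D j k x y h'

/-- The two transition maps supplied by the general statement are coequalised at a later stage. -/
theorem exists_le_of_isColimit_self {D : J ⥤ POMod P} {c : Limits.Cocone D}
    (hc : Limits.IsColimit c) {j : J} {x y : D.obj j}
    (h : app (c.ι.app j) x ≤ app (c.ι.app j) y) :
    ∃ (l : J) (f : j ⟶ l), app (D.map f) x ≤ app (D.map f) y := by
  obtain ⟨l, f, g, h⟩ := exists_le_of_isColimit hc h
  refine ⟨IsFiltered.coeq f g, f ≫ IsFiltered.coeqHom f g, ?_⟩
  have := app_mono (D.map (IsFiltered.coeqHom f g)) h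
  rwa [← app_map_comp, ← app_map_comp, ← IsFiltered.coeq_condition] at this

/-- Finitely many properties that hold from some stage on hold at a common stage. -/
theorem exists_common_stage {κ : Type*} [Finite κ] (j : J) (Q : κ → ∀ k : J, (j ⟶ k) → Prop)
    (hQ : ∀ i k l (f : j ⟶ k) (g : k ⟶ l), Q i k f → Q i l (f ≫ g))
    (h : ∀ i, ∃ k f, Q i k f) : ∃ k f, ∀ i, Q i k f := by
  classical
  have := Fintype.ofFinite κ
  suffices ∀ s : Finset κ, ∃ k f, ∀ i ∈ s, Q i k f by
    obtain ⟨k, f, hk⟩ := this Finset.univ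
    exact ⟨k, f, fun i => hk i (Finset.mem_univ i)⟩
  intro s
  induction s using Finset.induction_on with
  | empty => exact ⟨j, 𝟙 j, by simp⟩
  | insert i s _ ih =>
    obtain ⟨k, f, hk⟩ := ih
    obtain ⟨k', f', hk'⟩ := h i
    obtain ⟨l, a, b, hab⟩ := IsFiltered.span f f'
    refine ⟨l, f ≫ a, fun i' hi' => ?_⟩
    rcases Finset.mem_insert.1 hi' with rfl | hi'
    · rw [hab]
      exact hQ _ _ _ _ _ hk'
    · exact hQ _ _ _ _ _ (hk i' hi')

end Colimit

/-! ### Modules presented by a matrix are finitely presented -/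

section Basis

variable {M : POMod P} {I : Type u} {b : I → M}

theorem IsBasis.hom_ext (hb : M.IsBasis b) {N : POMod P} {f g : M ⟶ N}
    (h : ∀ i, app f (b i) = app g (b i)) : f = g := by
  refine POMod.hom_ext fun x => ?_
  rcases hb.eq_zero_or x with rfl | ⟨i, a, rfl⟩
  · rw [app_zero, app_zero]
  · rw [app_smul, app_smul, h]

theorem IsBasis.exists_linear (hb : M.IsBasis b) {N : POMod P} (n : I → N) :
    ∃ f : M → N, f 0 = 0 ∧ ∀ (i : I) (a : A), f (a • b i) = a • n i := by
  classical
  have : ∀ x : M, ∃ y : N, (x = 0 → y = 0) ∧ ∀ (i : I) (a : A), x = a • b i → y = a • n i := by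
    intro x
    by_cases hx : x = 0
    · subst hx
      refine ⟨0, fun _ => rfl, fun i a h => ?_⟩
      rw [hb.smul_eq_zero h.symm, zero_smul]
    · obtain ⟨i, a, rfl⟩ := hb.generates x hx
      refine ⟨a • n i, fun h => absurd h hx, fun j a' h => ?_⟩
      obtain ⟨rfl, rfl⟩ := hb.injective i j a a' (by rintro rfl; exact hx (zero_smul _ _)) h
      rfl
  choose f hf using this
  exact ⟨f, (hf 0).1 rfl, fun i a => (hf _).2 i a rfl⟩

/-- The universal property of the presentation: monotonicity need only be tested on generators of
the ideals `E i j`. -/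
theorem IsPresentedBy.exists_hom {E : I → I → FracIdeal P} (hE : M.IsPresentedBy b E)
    {N : POMod P} (n : I → N) {F : I → I → Finset A}
    (hF : ∀ i j, ∀ x ∈ (E i j).carrier, x = 0 ∨ ∃ c ∈ P.plus, ∃ f ∈ F i j, x = c * f)
    (h : ∀ i j, ∀ f ∈ F i j, f • n i ≤ n j) : ∃ f : M ⟶ N, ∀ i, app f (b i) = n i := by
  obtain ⟨f, hf0, hf⟩ := hE.basis.exists_linear n
  refine ⟨⟨f, hf0, fun a x => ?_, fun x y hxy => ?_⟩, fun i => ?_⟩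
  · rcases hE.basis.eq_zero_or x with rfl | ⟨i, c, rfl⟩
    · rw [smul_zero, hf0, smul_zero]
    · rw [← mul_smul, hf, hf, mul_smul]
  · rcases hE.basis.eq_zero_or x with rfl | ⟨i, a, rfl⟩
    · rw [hf0]; exact zero_le _
    rcases hE.basis.eq_zero_or y with rfl | ⟨j, a', rfl⟩
    · rw [le_zero_iff.1 hxy]
    obtain ⟨e, he, rfl⟩ := (hE.le_iff _ _ _ _).1 hxy
    rw [hf, hf]
    rcases hF i j e he with rfl | ⟨c, hc, g, hg, rfl⟩
    · rw [mul_zero, zero_smul]; exact zero_le _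
    · rw [mul_smul, mul_smul]
      exact N.smul_le_smul_right _ _ _ ((smul_le_of_mem hc _).trans (h i j g hg))
  · have := hf i 1
    rw [one_smul, one_smul] at this
    exact this

theorem IsPresentedBy.isFinitelyPresentable {E : I → I → FracIdeal P}
    (hE : M.IsPresentedBy b E) : IsFinitelyPresentable.{u} M := by
  have := hE.finite
  rw [isFinitelyPresentable_iff_preservesFilteredColimitsOfSize]
  refine ⟨fun J _ _ => ⟨fun {D} => ⟨fun {c} hc => ⟨?_⟩⟩⟩⟩
  choose F hFmem hF using fun i j => (E i j).fg
  refine Limits.Types.FilteredColimit.isColimitOf' _ _ (fun f => ?_) (fun j f g h => ?_)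
  · obtain ⟨j, g, hg⟩ : ∃ (j : J) (g : M ⟶ D.obj j), g ≫ c.ι.app j = (f : M ⟶ c.pt) := by
      choose st pt hpt using fun i => exists_of_isColimit hc (app (f : M ⟶ c.pt) (b i))
      obtain ⟨j, hj⟩ := IsFiltered.sup_objs_exists (Set.finite_range st).toFinset
      have φ : ∀ i, st i ⟶ j := fun i => (hj (by simp)).some
      let n : I → D.obj j := fun i => app (D.map (φ i)) (pt i)
      have hn : ∀ i, app (c.ι.app j) (n i) = app (f : M ⟶ c.pt) (b i) := fun i => by
        rw [app_cocone, hpt]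
      -- The finitely many inequalities required by `exists_hom` hold in the colimit, hence at some
      -- common stage.
      obtain ⟨k, ψ, hψ⟩ := exists_common_stage (κ := Σ p : I × I, {x // x ∈ F p.1 p.2}) j
        (fun q k ψ => q.2.1 • app (D.map ψ) (n q.1.1) ≤ app (D.map ψ) (n q.1.2))
        (fun q k l ψ θ h => by
          rw [app_map_comp, app_map_comp, ← app_smul]
          exact app_mono _ h)
        (fun q => by
          simp only [← app_smul]
          refine exists_le_of_isColimit_self hc ?_
          rw [app_smul, hn, hn, ← app_smul]
          exact app_mono _ (hE.mem_iff.1 (hFmem _ _ q.2.2)))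
      obtain ⟨g, hg⟩ := hE.exists_hom (fun i => app (D.map ψ) (n i)) hF
        fun i j x hx => hψ ⟨(i, j), x, hx⟩
      exact ⟨k, g, hE.basis.hom_ext fun i => by rw [app_comp, hg, app_cocone, hn]⟩
    exact ⟨j, g, hg.symm⟩
  · obtain ⟨k, ψ, hψ⟩ : ∃ (k : J) (ψ : j ⟶ k),
        (f : M ⟶ D.obj j) ≫ D.map ψ = (g : M ⟶ D.obj j) ≫ D.map ψ := by
      have h : (f : M ⟶ D.obj j) ≫ c.ι.app j = (g : M ⟶ D.obj j) ≫ c.ι.app j := h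
      have hfg : ∀ i, app (c.ι.app j) (app (f : M ⟶ D.obj j) (b i)) =
          app (c.ι.app j) (app (g : M ⟶ D.obj j) (b i)) := fun i => by
        rw [← app_comp, h, app_comp]
      -- The factor `Bool` encodes each equality on a basis element as two inequalities.
      obtain ⟨k, ψ, hψ⟩ := exists_common_stage (κ := I × Bool) j
        (fun q k ψ => app (D.map ψ) (app (if q.2 then f else g : M ⟶ D.obj j) (b q.1)) ≤
          app (D.map ψ) (app (if q.2 then g else f : M ⟶ D.obj j) (b q.1)))
        (fun q k l ψ θ h => by
          rw [app_map_comp, app_map_comp]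
          exact app_mono _ h)
        (fun q => by
          refine exists_le_of_isColimit_self hc ?_
          obtain ⟨i, - | -⟩ := q
          · exact (hfg i).ge
          · exact (hfg i).le)
      exact ⟨k, ψ, hE.basis.hom_ext fun i => le_antisymm (hψ (i, true)) (hψ (i, false))⟩
    exact ⟨k, ψ, hψ⟩

end Basis

end POMod

/-! ### Modules presented by a finite quiver -/

/-- When the last edge returns to a vertex visited earlier, the part of the path since that visit is
a loop. -/
theorem Quiver.Path.exists_loop_or_nodup {V : Type*} [Quiver V] {i j : V} (γ : Quiver.Path i j) :
    (∃ (k : V) (p : Quiver.Path i k) (l : Quiver.Path k k) (r : Quiver.Path k j),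
      γ = p.comp (l.comp r) ∧ 0 < l.length) ∨ γ.vertices.Nodup := by
  induction γ with
  | nil => right; simp
  | @cons m j p e ih =>
    rcases ih with ⟨k, q, l, r, rfl, hl⟩ | h
    · exact Or.inl ⟨k, q, l, r.cons e, rfl, hl⟩
    · by_cases hj : j ∈ p.vertices
      · obtain ⟨q, r, rfl⟩ := p.exists_eq_comp_of_mem_vertices hj
        exact Or.inl ⟨j, q, r.cons e, .nil, rfl, by simp⟩
      · right
        rw [Quiver.Path.vertices_cons]
        exact h.concat hj

namespace POMod

variable {A : Type u} [CommMonoidWithZero A] {P : F1Pair A} {I : Type u}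

section PathWeight

variable [Quiver.{u + 1} I] (w : ∀ {i j : I}, (i ⟶ j) → A)

theorem pathWeight_comp {i j k : I} (p : Quiver.Path i j) (q : Quiver.Path j k) :
    pathWeight w (p.comp q) = pathWeight w p * pathWeight w q := by
  induction q with
  | nil => rw [Quiver.Path.comp_nil, pathWeight, mul_one]
  | cons q e ih => rw [Quiver.Path.comp_cons, pathWeight, pathWeight, ih, mul_left_comm]

theorem pathWeight_toPath {i j : I} (e : i ⟶ j) : pathWeight w e.toPath = w e := by
  rw [Quiver.Hom.toPath, pathWeight, pathWeight, mul_one]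

/-- If loops have weight in `A⁺` then paths without repeated vertices suffice up to `A⁺`. -/
theorem exists_short_path [Finite I]
    (hloop : ∀ (i : I) (l : Quiver.Path i i), pathWeight w l ∈ P.plus)
    {i j : I} (γ : Quiver.Path i j) : ∃ (γ' : Quiver.Path i j) (c : A), c ∈ P.plus ∧
      γ'.length < Nat.card I ∧ pathWeight w γ = c * pathWeight w γ' := by
  induction hn : γ.length using Nat.strong_induction_on generalizing γ with
  | _ n ih =>
    rcases γ.exists_loop_or_nodup with ⟨k, p, l, r, rfl, hl⟩ | h
    · obtain ⟨γ', c, hc, hlen, h⟩ := ih (p.comp r).length (by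
        rw [← hn]; simp only [Quiver.Path.length_comp]; omega) (p.comp r) rfl
      refine ⟨γ', pathWeight w l * c, P.plus.mul_mem (hloop k l) hc, hlen, ?_⟩
      rw [mul_assoc, ← h, pathWeight_comp, pathWeight_comp, pathWeight_comp, mul_left_comm]
    · refine ⟨γ, 1, P.plus.one_mem, ?_, (one_mul _).symm⟩
      have := Fintype.ofFinite I
      -- A path has one more vertex than edges, hence the strict bound.
      have h1 := h.length_le_card
      rw [Quiver.Path.vertices_length, ← Nat.card_eq_fintype_card] at h1
      exact h1

theorem finite_pathWeight_of_length [Finite I] [∀ i j : I, Finite (i ⟶ j)] (i : I) (n : ℕ) :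
    ∀ j : I, {a : A | ∃ γ : Quiver.Path i j, γ.length = n ∧ pathWeight w γ = a}.Finite := by
  induction n with
  | zero =>
    intro j
    refine (Set.finite_singleton (1 : A)).subset ?_
    rintro a ⟨γ, hγ, rfl⟩
    cases γ with
    | nil => rw [pathWeight]; rfl
    | cons p e => simp at hγ
  | succ n ih =>
    intro j
    refine (Set.finite_iUnion fun k => Set.finite_iUnion fun e : k ⟶ j =>
      (ih k).image (w e * ·)).subset ?_
    rintro a ⟨γ, hγ, rfl⟩
    cases γ with
    | nil => simp at hγ
    | @cons k _ p e =>
      refine Set.mem_iUnion.2 ⟨k, Set.mem_iUnion.2 ⟨e, _, ⟨p, by simpa using hγ, rfl⟩, ?_⟩⟩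
      rw [pathWeight]

end PathWeight

variable {M : POMod P} {b : I → M}

/-- The ideal `E i j` consists of the `A⁺`-multiples of weights of paths from `j` to `i`. It is
finitely generated because non-degeneracy allows loops to be removed. -/
theorem IsBasis.exists_isPresentedBy [Quiver.{u + 1} I] {w : ∀ {i j : I}, (i ⟶ j) → A}
    [Finite I] [∀ i j : I, Finite (i ⟶ j)] (hb : M.IsBasis b)
    (hM : M.IsNondegenerate) (hle : ∀ x y : M, x ≤ y ↔ QuiverLE b w x y) :
    ∃ E : I → I → FracIdeal P, M.IsPresentedBy b E := by
  have hw : ∀ {i j : I} (e : i ⟶ j), w e • b j ≤ b i := fun {i j} e => by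
    rw [hle]
    refine Or.inr ⟨i, j, e.toPath, 1, 1, P.plus.one_mem, (one_smul _ _).symm, ?_⟩
    rw [pathWeight_toPath, one_mul, mul_one]
  have hloop : ∀ (i : I) (l : Quiver.Path i i), pathWeight w l ∈ P.plus := by
    intro i l
    obtain ⟨c, hc, h⟩ := (hM I b hb i (pathWeight w l • b i) (b i) ⟨_, rfl⟩
      ⟨1, (one_smul _ _).symm⟩).1 (pathWeight_smul_le hw l)
    rw [hb.smul_left_injective i h]
    exact hc
  have hfin : ∀ i j : I,
      {a : A | ∃ γ : Quiver.Path j i, γ.length < Nat.card I ∧ pathWeight w γ = a}.Finite := by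
    intro i j
    refine ((Set.finite_lt_nat (Nat.card I)).biUnion fun n _ =>
      finite_pathWeight_of_length w j n i).subset ?_
    rintro a ⟨γ, hγ, rfl⟩
    exact Set.mem_biUnion (show γ.length ∈ {n | n < Nat.card I} from hγ) ⟨γ, rfl, rfl⟩
  let E : I → I → FracIdeal P := fun i j => ∑ a ∈ (hfin i j).toFinset, FracIdeal.log P a
  have hE : ∀ (i j : I) (a : A), a ∈ (E i j).carrier ↔ a = 0 ∨
      ∃ (γ : Quiver.Path j i) (c : A), c ∈ P.plus ∧ a = c * pathWeight w γ := by
    intro i j a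
    rw [FracIdeal.mem_sum]
    refine or_congr_right ⟨?_, ?_⟩
    · rintro ⟨f, hf, c, hc, rfl⟩
      obtain ⟨γ, -, rfl⟩ := (hfin i j).mem_toFinset.1 hf
      exact ⟨γ, c, hc, rfl⟩
    · rintro ⟨γ, c, hc, rfl⟩
      obtain ⟨γ', c', hc', hlen, h⟩ := exists_short_path w hloop γ
      exact ⟨_, (hfin i j).mem_toFinset.2 ⟨γ', hlen, rfl⟩, c * c', P.plus.mul_mem hc hc', by
        rw [h, mul_assoc]⟩
  refine ⟨E, hb, inferInstance, fun i j a a' => ⟨fun h => ?_, ?_⟩⟩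
  · by_cases ha : a = 0
    · exact ⟨0, (E i j).zero_mem, by rw [ha, mul_zero]⟩
    rcases (hle _ _).1 h with h0 | ⟨i', j', γ, c, d, hc, h1, h2⟩
    · exact absurd (hb.smul_eq_zero h0) ha
    · obtain ⟨rfl, rfl⟩ := hb.injective _ _ _ _ ha h2
      have hd : d ≠ 0 := by
        rintro rfl
        exact ha (mul_zero _)
      obtain ⟨rfl, rfl⟩ := hb.injective _ _ _ _ hd h1.symm
      exact ⟨c * pathWeight w γ, (hE _ _ _).2 (Or.inr ⟨γ, c, hc, rfl⟩), mul_comm _ _⟩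
  · rintro ⟨e, he, rfl⟩
    rw [mul_smul]
    refine M.smul_le_smul_right _ _ _ ?_
    rcases (hE _ _ _).1 he with rfl | ⟨γ, c, hc, rfl⟩
    · rw [zero_smul]; exact zero_le _
    · rw [mul_smul]
      exact (smul_le_of_mem hc _).trans (pathWeight_smul_le hw γ)

theorem IsPresentedByFiniteQuiver.exists_isPresentedBy (h : M.IsPresentedByFiniteQuiver)
    (hM : M.IsNondegenerate) :
    ∃ (I : Type u) (b : I → M) (E : I → I → FracIdeal P), M.IsPresentedBy b E := by
  obtain ⟨I, b, q, w, hb, hI, hq, hle⟩ := h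
  obtain ⟨E, hE⟩ := hb.exists_isPresentedBy hM hle
  exact ⟨I, b, E, hE⟩

end POMod

/-! ### Finitely presented modules -/

namespace POMod

variable {A : Type u} [CommMonoidWithZero A] {P : F1Pair A}

/-- A preorder on `M` that is compatible with the action of `A`. -/
structure IsCompatible (M : POMod P) (r : M → M → Prop) : Prop where
  refl : ∀ x, r x x
  trans : ∀ x y z, r x y → r y z → r x z
  smul_left : ∀ (f g : A) (v : M), (∃ c ∈ P.plus, f = c * g) → r (f • v) (g • v)
  smul_right : ∀ (f : A) (v w : M), r v w → r (f • v) (f • w)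

/-- The compatible preorder generated by a set of pairs. -/
def GenLE (M : POMod P) (T : Set (M × M)) (x y : M) : Prop :=
  ∀ r : M → M → Prop, M.IsCompatible r → (∀ t ∈ T, r t.1 t.2) → r x y

theorem isCompatible_le (M : POMod P) : M.IsCompatible (· ≤ ·) :=
  ⟨fun _ => le_rfl, fun _ _ _ => le_trans, M.smul_le_smul_left, M.smul_le_smul_right⟩

/-- The pairs in the order of `M`. -/
abbrev OrderPair (M : POMod P) : Type u := {t : M × M // t.1 ≤ t.2}

variable {M : POMod P}

/-- The set of pairs underlying a finite set of inequalities. -/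
def pairs (T : Finset M.OrderPair) : Set (M × M) := {t | ∃ s ∈ T, s.1 = t}

theorem GenLE.le {T : Finset M.OrderPair} {x y : M} (h : M.GenLE (pairs T) x y) : x ≤ y :=
  h _ M.isCompatible_le (by rintro _ ⟨s, -, rfl⟩; exact s.2)

theorem GenLE.mono {T T' : Finset M.OrderPair} (hT : T ⊆ T') {x y : M}
    (h : M.GenLE (pairs T) x y) : M.GenLE (pairs T') x y :=
  fun r hr hr' => h r hr (by rintro _ ⟨s, hs, rfl⟩; exact hr' _ ⟨s, hT hs, rfl⟩)

/-- The module `M` with the order generated by finitely many of its inequalities. -/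
def withGenLE (T : Finset M.OrderPair) : POMod P where
  carrier := M
  order :=
    { le := M.GenLE (pairs T)
      lt := fun x y => M.GenLE (pairs T) x y ∧ ¬M.GenLE (pairs T) y x
      le_refl := fun x _ hr _ => hr.refl x
      le_trans := fun x y z h h' r hr hr' => hr.trans x y z (h r hr hr') (h' r hr hr')
      le_antisymm := fun _ _ h h' => le_antisymm h.le h'.le }
  smul_le_smul_left := fun f g v h _ hr _ => hr.smul_left f g v h
  smul_le_smul_right := fun f v w h r hr hr' => hr.smul_right f v w (h r hr hr')

/-- The diagram of the modules `withGenLE T`. -/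
def genDiagram (M : POMod P) : Finset M.OrderPair ⥤ POMod P where
  obj T := withGenLE T
  map f := ⟨id, rfl, fun _ _ => rfl, fun _ _ h => GenLE.mono (leOfHom f) h⟩

/-- The cocone with point `M` on `genDiagram M`. -/
def genCocone (M : POMod P) : Limits.Cocone M.genDiagram where
  pt := M
  ι := { app := fun _ => ⟨id, rfl, fun _ _ => rfl, fun _ _ h => GenLE.le h⟩ }

/-- `M` is the filtered colimit of its underlying module with the orders generated by finite sets of
inequalities. The identity factors through some stage `T`, and monotonicity of that factor is the
claim. -/
theorem exists_genLE (M : POMod P) [IsFinitelyPresentable.{u} M] :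
    ∃ T : Finset M.OrderPair, ∀ x y : M, x ≤ y → M.GenLE (pairs T) x y := by
  classical
  have hc : Limits.IsColimit M.genCocone := by
    refine isColimitOf _ (fun z => ⟨∅, z, rfl⟩) fun S T x y h => ?_
    refine ⟨S ∪ T ∪ {⟨(x, y), h⟩},
      homOfLE (Finset.subset_union_left.trans Finset.subset_union_left),
      homOfLE (Finset.subset_union_right.trans Finset.subset_union_left), ?_⟩
    exact fun r _ hr => hr (x, y) ⟨⟨(x, y), h⟩, by simp, rfl⟩
  obtain ⟨T, g, hg⟩ := IsFinitelyPresentable.exists_hom_of_isColimit hc (𝟙 M)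
  have hid : ∀ x, app g x = x := fun x => by
    change app (g ≫ M.genCocone.ι.app T) x = x
    rw [hg]
    rfl
  refine ⟨T, fun x y h => ?_⟩
  have := app_mono g h
  rw [hid, hid] at this
  exact this

section Basis

variable {I : Type u} {b : I → M}

/-- The submodule of `M` generated by finitely many members of the family `b`. -/
def spanPOMod (b : I → M) (S : Finset I) : POMod P :=
  letI : Zero {x : M // x = 0 ∨ ∃ i ∈ S, ∃ a : A, x = a • b i} := ⟨⟨0, Or.inl rfl⟩⟩
  { carrier := {x : M // x = 0 ∨ ∃ i ∈ S, ∃ a : A, x = a • b i}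
    action :=
      { smul := fun a x => ⟨a • x.1, by
          rcases x.2 with h | ⟨i, hi, c, h⟩
          · exact Or.inl (by rw [h, smul_zero])
          · exact Or.inr ⟨i, hi, a * c, by rw [h, mul_smul]⟩⟩
        one_smul := fun x => Subtype.ext (one_smul A x.1)
        mul_smul := fun a b x => Subtype.ext (mul_smul a b x.1)
        smul_zero := fun a => Subtype.ext (smul_zero a)
        zero_smul := fun x => Subtype.ext (zero_smul A x.1) }
    order := Subtype.partialOrder _
    smul_le_smul_left := fun f g v h => M.smul_le_smul_left f g v.1 h
    smul_le_smul_right := fun f v w h => M.smul_le_smul_right f v.1 w.1 h }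

/-- The diagram of the modules `spanPOMod b S`. -/
def spanDiagram (b : I → M) : Finset I ⥤ POMod P where
  obj S := spanPOMod b S
  map {S T} f :=
    { toFun := fun x => ⟨x.1, x.2.imp_right fun ⟨i, hi, h⟩ => ⟨i, leOfHom f hi, h⟩⟩
      map_zero := rfl
      map_smul := fun _ _ => rfl
      monotone := fun _ _ h => h }

/-- The cocone with point `M` on `spanDiagram b`. -/
def spanCocone (b : I → M) : Limits.Cocone (spanDiagram b) where
  pt := M
  ι := { app := fun _ => ⟨Subtype.val, rfl, fun _ _ => rfl, fun _ _ h => h⟩ }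

/-- `M` is the filtered union of the spans of finite subfamilies of `b`; the identity factors
through one of them, which then contains every `b i`. -/
theorem IsBasis.finite (hP : P.IsDomain) (hb : M.IsBasis b) [IsFinitelyPresentable.{u} M] :
    Finite I := by
  classical
  have hc : Limits.IsColimit (spanCocone b) := by
    refine isColimitOf _ (fun z => ?_) fun S T x y h => ⟨S ∪ T,
      homOfLE Finset.subset_union_left, homOfLE Finset.subset_union_right, h⟩
    rcases hb.eq_zero_or z with h | ⟨i, a, h⟩
    · exact ⟨∅, ⟨z, Or.inl h⟩, rfl⟩
    · exact ⟨{i}, ⟨z, Or.inr ⟨i, Finset.mem_singleton_self i, a, h⟩⟩, rfl⟩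
  obtain ⟨S, g, hg⟩ := IsFinitelyPresentable.exists_hom_of_isColimit hc (𝟙 M)
  have hS : ∀ i, i ∈ S := by
    intro i
    have hid : (app g (b i)).1 = b i := by
      change app (g ≫ (spanCocone b).ι.app S) (b i) = b i
      rw [hg]
      rfl
    rcases (app g (b i)).2 with h | ⟨j, hj, a, h⟩
    · exact absurd (hid.symm.trans h) (hb.ne_zero hP i)
    · have := hb.injective i j 1 a hP.nontrivial.symm
        (by rw [one_smul]; exact hid.symm.trans h)
      rw [this.1]
      exact hj
  exact Set.finite_univ_iff.1 (S.finite_toSet.subset fun i _ => hS i)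

/-- For lower submodules of a `K_A`-module, the order is determined by divisibility. -/
theorem IsLowerInFrac.exists_factor (hP : P.IsDomain) (hM : M.IsLowerInFrac) (hb : M.IsBasis b)
    {i j : I} {a a' : A} (ha : a ≠ 0) (h : a • b i ≤ a' • b j) :
    ∃ e, a = a' * e ∧ e • b i ≤ b j := by
  have ha' : a' ≠ 0 := by
    rintro rfl
    rw [zero_smul, le_zero_iff] at h
    exact hb.smul_ne_zero i a ha h
  let s : nonZeroDivisors A := ⟨a', hP.mem_nonZeroDivisors ha'⟩
  -- Divide the inequality by `a'`: the fraction `(a • b i) / a'` lies below `b j`, so lowerness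
  -- makes it an element of `M`.
  have hle : M.fracLE (OreLocalization.oreDiv (a • b i) s) (M.toFrac (b j)) :=
    ⟨a • b i, a' • b j, s, h, rfl, (hb.toFrac_eq_iff hP).2 rfl⟩
  obtain ⟨m, hm⟩ := hM.lower _ _ hle
  rw [hm, hM.le_iff] at hle
  have hm' : a' • m = a • b i := (hb.toFrac_eq_iff hP).1 hm.symm
  rcases hb.eq_zero_or m with rfl | ⟨k, e, rfl⟩
  · rw [smul_zero] at hm'
    exact absurd hm'.symm (hb.smul_ne_zero i a ha)
  · rw [← mul_smul] at hm'
    obtain ⟨rfl, rfl⟩ := hb.injective i k _ _ ha hm'.symm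
    exact ⟨e, rfl, hle⟩

/-- Compatibility lets the generated order be tested against `QuiverLE`; transitivity is
concatenation of paths. -/
theorem IsBasis.isCompatible_quiverLE [Quiver.{u + 1} I] {w : ∀ {i j : I}, (i ⟶ j) → A}
    (hb : M.IsBasis b) : M.IsCompatible (QuiverLE b w) where
  refl x := by
    rcases hb.eq_zero_or x with h | ⟨i, a, h⟩
    · exact Or.inl h
    · refine Or.inr ⟨i, i, .nil, 1, a, P.plus.one_mem, h, ?_⟩
      rw [pathWeight, one_mul, one_mul, h]
  trans x y z := by
    rintro (hx | ⟨i, j, γ, c, a, hc, rfl, rfl⟩) h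
    · exact Or.inl hx
    by_cases ha : a = 0
    · left
      rw [ha, mul_zero, zero_smul]
    rcases h with h | ⟨i', j', γ', c', a', hc', rfl, h⟩
    · exact absurd (hb.smul_eq_zero h) ha
    · obtain ⟨rfl, rfl⟩ := hb.injective _ _ _ _ ha h
      refine Or.inr ⟨i', j, γ'.comp γ, c * c', a', P.plus.mul_mem hc hc', rfl, ?_⟩
      rw [pathWeight_comp]
      congr 1
      ac_rfl
  smul_left := by
    rintro f g v ⟨c, hc, rfl⟩
    rcases hb.eq_zero_or v with rfl | ⟨i, a, rfl⟩
    · exact Or.inl (smul_zero _)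
    · refine Or.inr ⟨i, i, .nil, c, g * a, hc, (mul_smul _ _ _).symm, ?_⟩
      rw [pathWeight, ← mul_smul, mul_one, mul_assoc]
  smul_right f v w := by
    rintro (rfl | ⟨i, j, γ, c, a, hc, rfl, rfl⟩)
    · exact Or.inl (smul_zero _)
    · refine Or.inr ⟨i, j, γ, c, f * a, hc, (mul_smul _ _ _).symm, ?_⟩
      rw [← mul_smul]
      congr 1
      ac_rfl

/-- Each of the finitely many generating inequalities `a • b j ≤ a' • b i` with `a ≠ 0` divides to
`e • b j ≤ b i`, and so gives one edge of weight `e`. -/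
theorem IsLowerInFrac.isPresentedByFiniteQuiver (hP : P.IsDomain) (hM : M.IsLowerInFrac)
    (hfree : M.IsFree) [IsFinitelyPresentable.{u} M] : M.IsPresentedByFiniteQuiver := by
  obtain ⟨I, b, hb⟩ := hfree
  obtain ⟨T, hT⟩ := M.exists_genLE
  let edge : I → I → Type u := fun i j => {t : {t // t ∈ T} // ∃ e a' : A,
    t.1.1.1 = (a' * e) • b j ∧ t.1.1.2 = a' • b i ∧ e • b j ≤ b i}
  let q : Quiver.{u + 1} I := ⟨fun i j => ULift.{u + 1} (edge i j)⟩
  let w : ∀ {i j : I}, (i ⟶ j) → A := fun e => (ULift.down e).2.choose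
  have hw : ∀ {i j : I} (e : i ⟶ j), w e • b j ≤ b i := fun e =>
    (ULift.down e).2.choose_spec.choose_spec.2.2
  refine ⟨I, b, q, w, hb, hb.finite hP,
    fun i j => inferInstanceAs (Finite (ULift.{u + 1} (edge i j))),
    fun x y => ⟨fun h => hT x y h _ hb.isCompatible_quiverLE ?_, QuiverLE.le hw⟩⟩
  rintro _ ⟨t, ht, rfl⟩
  rcases hb.eq_zero_or t.1.1 with h1 | ⟨j, a, h1⟩
  · exact Or.inl h1
  by_cases ha : a = 0
  · left
    rw [h1, ha, zero_smul]
  rcases hb.eq_zero_or t.1.2 with h2 | ⟨i, a', h2⟩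
  · left
    have := t.2
    rwa [h2, le_zero_iff] at this
  have hle := t.2
  rw [h1, h2] at hle
  obtain ⟨e, rfl, he⟩ := hM.exists_factor hP hb ha hle
  let ε : i ⟶ j := ⟨⟨⟨t, ht⟩, e, a', h1, h2, he⟩⟩
  -- The weight `w ε` is chosen from the existential carried by the edge and need not be
  -- syntactically `e`, so the decomposition is read again from its specification.
  obtain ⟨d, h3, h4, -⟩ : ∃ d : A, t.1.1 = (d * w ε) • b j ∧ t.1.2 = d • b i ∧ w ε • b j ≤ b i :=
    (ULift.down ε).2.choose_spec
  refine Or.inr ⟨i, j, ε.toPath, 1, d, P.plus.one_mem, h4, ?_⟩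
  rw [h3, pathWeight_toPath, one_mul, mul_comm]

end Basis

end POMod

/-! ### The two characterisations of finitely generated projective modules -/

theorem mainTheorem1 {A : Type u} [CommMonoidWithZero A] (P : F1Pair A) (hP : P.IsDomain)
    (μ : Type u) [AddCommMonoid μ] [Module (FracIdeal P) μ] :
    ((Module.Finite (FracIdeal P) μ ∧ Module.Projective (FracIdeal P) μ) ↔
      (HasUniqueIrredundantDecompositions μ ∧
        ∃ h : PrimIsSubmodule μ P,
          (primPOMod h).IsFree ∧ (primPOMod h).IsNondegenerate ∧
          (primPOMod h).IsPresentedByFiniteQuiver)) ∧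
    ((Module.Finite (FracIdeal P) μ ∧ Module.Projective (FracIdeal P) μ) ↔
      (HasUniqueIrredundantDecompositions μ ∧
        ∃ h : PrimIsSubmodule μ P,
          (primPOMod h).IsFree ∧ (primPOMod h).IsNondegenerate ∧
          (primPOMod h).IsLowerInFrac ∧
          IsFinitelyPresentable.{u} (primPOMod h))) := by
  have key : (∃ h : PrimIsSubmodule μ P, ∃ (I : Type u) (b : I → primPOMod h)
        (E : I → I → FracIdeal P), (primPOMod h).IsPresentedBy b E) ∧
      HasUniqueIrredundantDecompositions μ ↔
      Module.Finite (FracIdeal P) μ ∧ Module.Projective (FracIdeal P) μ := by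
    constructor
    · rintro ⟨⟨h, I, b, E, hE⟩, huniq⟩
      exact hE.finite_projective huniq
    · rintro ⟨_, _⟩
      exact (exists_isPresentedBy_of_projective hP).symm
  refine ⟨⟨fun hμ => ?_, ?_⟩, ⟨fun hμ => ?_, ?_⟩⟩
  · obtain ⟨⟨h, I, b, E, hE⟩, huniq⟩ := key.2 hμ
    exact ⟨huniq, h, ⟨I, b, hE.basis⟩, hE.isNondegenerate hP, hE.isPresentedByFiniteQuiver⟩
  · rintro ⟨huniq, h, -, hnd, hq⟩
    exact key.1 ⟨⟨h, hq.exists_isPresentedBy hnd⟩, huniq⟩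
  · obtain ⟨⟨h, I, b, E, hE⟩, huniq⟩ := key.2 hμ
    exact ⟨huniq, h, ⟨I, b, hE.basis⟩, hE.isNondegenerate hP, hE.isLowerInFrac hP,
      hE.isFinitelyPresentable⟩
  · rintro ⟨huniq, h, hfree, hnd, hlow, hfp⟩
    exact key.1 ⟨⟨h, (hlow.isPresentedByFiniteQuiver hP hfree).exists_isPresentedBy hnd⟩, huniq⟩
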